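/- A $k$-graph is a pair $(X,\mathscr M)$ with $X$ a finite set and $\mathscr M$ a set of $k$-element subsets of $X$. A sub-$k$-graph of $(X,\mathscr M)$ is a $k$-graph $(X',\mathscr M')$ with $X'\subseteq X$ and $\mathscr M'\subseteq\mathscr M$ (not necessarily induced); it is proper if $(X',\mathscr M')\neq(X,\mathscr M)$. A $k$-graph is asymmetric if the identity is its only automorphism, and an involution is a non-identity automorphism $\phi$ with $\phi\circ\phi=\mathrm{id}$. For $m\ge 4$ let $G_m$ be the $m$-graph with vertices $v_1,\dots,v_{2m-1}$ and edges $M_i=\{v_i,v_{i+1},\dots,v_{i+m-1}\}$, $1\le i\le m$, and let $G^*_m$ be obtained from $G_m$ by adding one vertex $x$ and the edge $M_{m+1}=\{x,v_1,\dots,v_{m-2},v_{m+2}\}$. The last two vertices of $G_m$ are $v_{2m-2}$ and $v_{2m-1}$. For $k\ge 6$ and $s\ge 0$ the $k$-graph $G_{k,s}$ is built from pairwise disjoint blocks on layers $1,\dots,s+2$. Layer $s+2$ consists of one copy of $G^*_{k-2}$. For each $l=s+1,s,\dots,1$, layer $l$ has exactly one block for each edge of each block on layer $l+1$; this block is a copy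 of $G_{k-2}$ if $l\ge 2$ and a copy of $G_k$ if $l=1$. The vertices of $G_{k,s}$ are all vertices of the blocks. The edges of $G_{k,s}$ are the edges of the blocks on layer $1$ and, for each edge $M$ of a block on a layer $l+1\ge 2$, the set consisting of $M$ and the last two vertices of the block on layer $l$ that corresponds to $M$. **Theorem.** For every integer $k\ge 6$ there are infinitely many pairwise non-isomorphic $k$-graphs $(X,\mathscr M)$ such that 1. $(X,\mathscr M)$ is asymmetric, and 2. every proper sub-$k$-graph of $(X,\mathscr M)$ with at least two vertices has an involution. More precisely, for every $k\ge 6$ the hypergraphs $G_{k,s}$, $s=0,1,2,\dots$, are pairwise non-isomorphic $k$-graphs, and each of them has the properties 1 and 2. -/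

import Mathlib

namespace Hypergraph

open scoped Hypergraph

/-- `H` is a (finite) `k`-graph: finitely many vertices, every edge has exactly `k` elements. -/
def IsKGraph {α : Type*} (H : Hypergraph α) (k : ℕ) : Prop :=
  V(H).Finite ∧ ∀ e ∈ E(H), e.ncard = k

/-- The bijection `φ` between the vertex sets is an isomorphism: a set of vertices is an edge
of `H` if and only if its image is an edge of `K`. -/
def IsIso {α β : Type*} {H : Hypergraph α} {K : Hypergraph β} (φ : V(H) ≃ V(K)) : Prop :=
  ∀ e : Set V(H), Subtype.val '' e ∈ E(H) ↔ Subtype.val '' (φ '' e) ∈ E(K)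

/-- `H` and `K` are isomorphic. -/
def Isomorphic {α β : Type*} (H : Hypergraph α) (K : Hypergraph β) : Prop :=
  ∃ φ : V(H) ≃ V(K), IsIso φ

/-- The only automorphism of `H` is the identity. -/
def IsAsymmetric {α : Type*} (H : Hypergraph α) : Prop :=
  ∀ φ : V(H) ≃ V(H), IsIso φ → φ = Equiv.refl _

/-- `H` has a non-identity automorphism `φ` with `φ ∘ φ = id`. -/
def HasInvolution {α : Type*} (H : Hypergraph α) : Prop :=
  ∃ φ : V(H) ≃ V(H), IsIso φ ∧ φ ≠ Equiv.refl _ ∧ ∀ v, φ (φ v) = v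

/-- `H` is a (not necessarily induced) subhypergraph of `G`. -/
def IsSubhypergraph {α : Type*} (H G : Hypergraph α) : Prop :=
  V(H) ⊆ V(G) ∧ E(H) ⊆ E(G)

/-! ### The blocks `G_m` and `G*_m`

The vertex `v_j` is the number `j`, the additional vertex `x` of `G*_m` is the number `0`. -/

/-- The vertices `v_1, …, v_{2m-1}` of `G_m`. -/
def blockVerts (m : ℕ) : Set ℕ := Set.Icc 1 (2 * m - 1)

/-- The edge `M_i = {v_i, …, v_{i+m-1}}` of `G_m`, to be used for `1 ≤ i ≤ m`. -/
def blockEdge (m i : ℕ) : Set ℕ := Set.Icc i (i + m - 1)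

/-- The vertices `x, v_1, …, v_{2m-1}` of `G*_m`. -/
def starVerts (m : ℕ) : Set ℕ := insert 0 (blockVerts m)

/-- The edges of `G*_m`, numbered by `1, …, m + 1`: the edges `M_1, …, M_m` of `G_m`, and
`M* = {x, v_1, …, v_{m-2}, v_{m+2}}` as number `m + 1`. -/
def starEdge (m i : ℕ) : Set ℕ :=
  if i = m + 1 then insert 0 (insert (m + 2) (Set.Icc 1 (m - 2))) else blockEdge m i

/-! ### The layered composition `G_{k,s}`

The copies of the blocks are indexed by lists: `[i_l, i_{l+1}, …, i_{s+1}]` is the copy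
`G(i_l, …, i_{s+1})` on layer `l`, for `1 ≤ l ≤ s + 1`, and `[]` is the copy of `G*_{k-2}` on
layer `s + 2`. So a list of length `s + 1` is a copy of `G_k` on layer `1`, and the lists of
length `1, …, s` are the copies of `G_{k-2}`. -/

/-- The number of edges of the copy `p`. -/
def copyNumEdges (k s : ℕ) (p : List ℕ) : ℕ :=
  if p = [] then k - 1 else if p.length = s + 1 then k else k - 2

/-- The vertices of the copy `p`. -/
def copyVerts (k s : ℕ) (p : List ℕ) : Set ℕ :=
  if p = [] then starVerts (k - 2) else if p.length = s + 1 then blockVerts k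
  else blockVerts (k - 2)

/-- The `i`-th edge of the copy `p`, before it is enlarged. -/
def copyEdge (k s : ℕ) (p : List ℕ) (i : ℕ) : Set ℕ :=
  if p = [] then starEdge (k - 2) i else if p.length = s + 1 then blockEdge k i
  else blockEdge (k - 2) i

/-- The last two vertices `v_{2m-2}, v_{2m-1}` of the copy `p ≠ []`, which is a copy of `G_m`
with `m = k` on layer `1` and `m = k - 2` above it. -/
def copyLastTwo (k s : ℕ) (p : List ℕ) : Set ℕ :=
  if p.length = s + 1 then {2 * k - 2, 2 * k - 1} else {2 * (k - 2) - 2, 2 * (k - 2) - 1}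

/-- `IsCopy k s p`: the list `p` is the index of a copy. Below layer `s + 2` there is one copy
`i :: p` on the next lower layer for each edge number `i` of a copy `p` that is not on layer `1`. -/
inductive IsCopy (k s : ℕ) : List ℕ → Prop
  | nil : IsCopy k s []
  | cons (i : ℕ) (p : List ℕ) : IsCopy k s p → p.length ≤ s → 1 ≤ i → i ≤ copyNumEdges k s p →
      IsCopy k s (i :: p)

/-- The edge of `G_{k,s}` that comes from the `i`-th edge of the copy `p`: on layer `1` it is this
edge itself, on higher layers it is enlarged by the last two vertices of the copy `i :: p`. -/
def layeredEdge (k s : ℕ) (p : List ℕ) (i : ℕ) : Set (List ℕ × ℕ) :=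
  Prod.mk p '' copyEdge k s p i ∪
    if p.length = s + 1 then ∅ else Prod.mk (i :: p) '' copyLastTwo k s (i :: p)

theorem IsCopy.length_le {k s : ℕ} {p : List ℕ} (h : IsCopy k s p) : p.length ≤ s + 1 := by
  cases h with
  | nil => simp
  | cons i p _ hl _ _ => simpa using hl

/-- The layered composition `G_{k,s}`; the pair `(p, j)` is the vertex number `j` of the
copy `p`. -/
def layered (k s : ℕ) (hk : 6 ≤ k) : Hypergraph (List ℕ × ℕ) where
  vertexSet := {x | IsCopy k s x.1 ∧ x.2 ∈ copyVerts k s x.1}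
  edgeSet := {e | ∃ p i, IsCopy k s p ∧ 1 ≤ i ∧ i ≤ copyNumEdges k s p ∧ e = layeredEdge k s p i}
  subset_vertexSet_of_mem_edgeSet' := by
    rintro e ⟨p, i, hp, hi, hi', rfl⟩ x (⟨j, hj, rfl⟩ | hx)
    · refine ⟨hp, ?_⟩
      simp only [copyEdge, copyVerts, copyNumEdges, starEdge, starVerts, blockEdge,
        blockVerts] at *
      split_ifs at * <;> simp only [Set.mem_insert_iff, Set.mem_Icc] at * <;> omega
    · split_ifs at hx with h
      · exact hx.elim
      · obtain ⟨j, hj, rfl⟩ := hx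
        have hl := hp.length_le
        refine ⟨.cons i p hp (by omega) hi hi', ?_⟩
        simp only [copyLastTwo, copyVerts, blockVerts, reduceCtorEq, if_false] at *
        split_ifs at * <;>
          simp only [Set.mem_insert_iff, Set.mem_singleton_iff, Set.mem_Icc] at * <;> omega

end Hypergraph

/-!
Let `H` be a subhypergraph of `G_{k,s}` without an involution and with at least two vertices. An
edge of `G_{k,s}` that meets a copy of `G_m` is one of its edges `M_1, …, M_m` or its link edge,
the enlarged edge above it, and only `M_i` among the former separates `v_{i-1}` from `v_i`, or
`v_{i+m-1}` from `v_{i+m}`. Two vertices of `H` in the same edges of `H` could be exchanged, so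
one edge of the copy in `H` forces all of them. If the link edge were missing, the reversal
`v_j ↦ v_{2m-j}`, which carries the copies below along, would be an involution; if only the link
edge were present, it would contain the last two vertices of the copy as twins. Hence what hangs
below an edge of the top copy is in `H` if and only if that edge is. In the top copy the twins
leave two possible defects: only `M*` is missing, which the reversal excludes, or only `M_{m-1}`
is missing, where `v_{2m-2}` and `v_{2m-1}` are twins if `m > 4` and an exceptional involution
exists if `m = 4`.

For asymmetry, an automorphism that fixes every edge is trivial because there are no twins. The
degree of `v_m` exceeds that of all other vertices of `M_m`, so once `M_m` is fixed so is `v_m`,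
and then `M_i` is recognised as the edge other than the link edge that contains `v_m` and meets
`M_m` in `i` vertices. In the top copy `M*` is fixed since it has only vertices of small degree,
and `M_m` since it meets `M*` and has a vertex of degree one outside `M*`. Below, `M_m` is the
only edge disjoint from the copy above that contains both vertices that the copy shares with its
link edge.
-/

namespace LayeredComposition

open Hypergraph
open scoped Hypergraph

/-! ### Involutions and isomorphisms of hypergraphs -/

section Hypergraphs

variable {α β : Type*} {H : Hypergraph α} {K : Hypergraph β}

/-- Two vertices are twins if they lie in the same edges. -/
def AreTwins (H : Hypergraph α) (x y : α) : Prop := ∀ e ∈ E(H), x ∈ e ↔ y ∈ e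

theorem hasInvolution_of_involutive {f : α → α} (hf : Function.Involutive f)
    (hV : ∀ x ∈ V(H), f x ∈ V(H)) (hE : ∀ e ∈ E(H), f '' e ∈ E(H)) {x : α} (hx : x ∈ V(H))
    (hfx : f x ≠ x) : HasInvolution H := by
  let g : V(H) → V(H) := fun v => ⟨f v, hV v v.2⟩
  have hg : Function.Involutive g := fun v => Subtype.ext (hf v)
  have himage : ∀ e : Set V(H), Subtype.val '' (g '' e) = f '' (Subtype.val '' e) := fun e => by
    simp only [Set.image_image, g]
  refine ⟨hg.toPerm, fun e => ?_, fun h => hfx ?_, hg⟩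
  · rw [hg.coe_toPerm, himage]
    refine ⟨hE _, fun h => ?_⟩
    have := hE _ h
    rwa [← Set.image_comp, hf.comp_self, Set.image_id] at this
  · exact congrArg Subtype.val (DFunLike.congr_fun h ⟨x, hx⟩)

theorem hasInvolution_of_image_mem_edgeSet {f : α → α} (hf : Function.Involutive f)
    (hE : ∀ e ∈ E(H), f '' e ∈ E(H)) {e : Set α} (he : e ∈ E(H)) {x : α} (hx : x ∈ e)
    (hfx : f x ≠ x) : HasInvolution H := by
  classical
  -- `f` may move an isolated vertex out of `V(H)`, so it is only used on the other vertices.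
  let g : α → α := fun y => if y ∈ ⋃₀ E(H) then f y else y
  have hmem : ∀ y ∈ ⋃₀ E(H), f y ∈ ⋃₀ E(H) := by
    rintro y ⟨d, hd, hy⟩
    exact ⟨f '' d, hE d hd, Set.mem_image_of_mem f hy⟩
  refine hasInvolution_of_involutive (f := g) (fun y => ?_) (fun y hy => ?_) (fun d hd => ?_)
    (mem_vertexSet_of_mem_edgeSet he hx) ?_
  · by_cases hy : y ∈ ⋃₀ E(H)
    · simp only [g, if_pos hy, if_pos (hmem y hy), hf y]
    · simp only [g, if_neg hy]
  · by_cases hy' : y ∈ ⋃₀ E(H)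
    · obtain ⟨d, hd, hyd⟩ := hmem y hy'
      simpa only [g, if_pos hy'] using mem_vertexSet_of_mem_edgeSet hd hyd
    · simpa only [g, if_neg hy'] using hy
  · rw [Set.image_congr fun y hy => if_pos (Set.mem_sUnion_of_mem hy hd)]
    exact hE d hd
  · simpa only [g, if_pos (Set.mem_sUnion_of_mem hx he)] using hfx

theorem hasInvolution_of_areTwins {x y : α} (hxy : x ≠ y) (hx : x ∈ V(H)) (hy : y ∈ V(H))
    (h : AreTwins H x y) : HasInvolution H := by
  classical
  refine hasInvolution_of_involutive (f := Equiv.swap x y) (Equiv.swap_apply_self x y)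
    (fun z hz => ?_) (fun e he => ?_) hx (by rwa [Equiv.swap_apply_left, ne_comm])
  · rw [Equiv.swap_apply_def]
    split_ifs <;> assumption
  · suffices Equiv.swap x y '' e = e by rwa [this]
    ext z
    rw [Equiv.image_eq_preimage_symm, Equiv.symm_swap, Set.mem_preimage, Equiv.swap_apply_def]
    split_ifs with hzx hzy
    · rw [hzx, h e he]
    · rw [hzy, h e he]
    · rfl

/-- The image of a set `e` of vertices of `H` under a bijection between vertex sets, as a set in
the ambient type; elements of `e` that are not vertices are ignored. -/
def mapEdge (φ : V(H) ≃ V(K)) (e : Set α) : Set β :=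
  Subtype.val '' (φ '' (Subtype.val ⁻¹' e))

/-- The degree of a vertex: the number of edges that contain it (`0` if there are infinitely
many). -/
noncomputable def degree (H : Hypergraph α) (x : α) : ℕ := {e ∈ E(H) | x ∈ e}.ncard

section Isomorphism

variable {φ : V(H) ≃ V(K)} {e f : Set α}

theorem mem_mapEdge (x : V(H)) : (φ x : β) ∈ mapEdge φ e ↔ (x : α) ∈ e := by
  simp [mapEdge]

theorem exists_of_mem_mapEdge {y : β} (h : y ∈ mapEdge φ e) :
    ∃ x : V(H), (x : α) ∈ e ∧ (φ x : β) = y := by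
  obtain ⟨_, ⟨x, hx, rfl⟩, rfl⟩ := h
  exact ⟨x, hx, rfl⟩

theorem mapEdge_injOn : Set.InjOn (mapEdge φ) E(H) := by
  intro e he f hf h
  refine (edgeSet.ext_iff he hf).2 fun x hx => ?_
  rw [← mem_mapEdge (φ := φ) ⟨x, hx⟩, h, mem_mapEdge]

theorem mapEdge_mem_edgeSet (hφ : IsIso φ) (he : e ∈ E(H)) : mapEdge φ e ∈ E(K) := by
  refine (hφ _).1 ?_
  rwa [Subtype.image_preimage_coe, Set.inter_eq_right.2 he.subset_vertexSet]

theorem exists_mapEdge_eq (hφ : IsIso φ) {d : Set β} (hd : d ∈ E(K)) :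
    ∃ e ∈ E(H), mapEdge φ e = d := by
  have hval : Subtype.val '' (Subtype.val ⁻¹' d : Set V(K)) = d := by
    rw [Subtype.image_preimage_coe, Set.inter_eq_right.2 hd.subset_vertexSet]
  refine ⟨Subtype.val '' (φ ⁻¹' (Subtype.val ⁻¹' d)), (hφ _).2 ?_, ?_⟩
  · rwa [Set.image_preimage_eq _ φ.surjective, hval]
  · rw [mapEdge, Set.preimage_image_eq _ Subtype.val_injective,
      Set.image_preimage_eq _ φ.surjective, hval]

theorem ncard_mapEdge_inter (he : e ∈ E(H)) :
    (mapEdge φ e ∩ mapEdge φ f).ncard = (e ∩ f).ncard := by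
  have hinter : mapEdge φ e ∩ mapEdge φ f = mapEdge φ (e ∩ f) := by
    simp only [mapEdge, Set.preimage_inter, Set.image_inter φ.injective,
      Set.image_inter Subtype.val_injective]
  rw [hinter, mapEdge, Set.ncard_image_of_injective _ Subtype.val_injective,
    Set.ncard_image_of_injective _ φ.injective,
    ← Set.ncard_image_of_injective _ Subtype.val_injective, Subtype.image_preimage_coe,
    Set.inter_eq_right.2 (Set.inter_subset_left.trans he.subset_vertexSet)]

theorem degree_apply_eq (hφ : IsIso φ) (x : V(H)) : degree K (φ x) = degree H x := by
  have himage : {d ∈ E(K) | (φ x : β) ∈ d} = mapEdge φ '' {e ∈ E(H) | (x : α) ∈ e} := by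
    ext d
    constructor
    · rintro ⟨hd, hx⟩
      obtain ⟨e, he, rfl⟩ := exists_mapEdge_eq hφ hd
      exact ⟨e, ⟨he, (mem_mapEdge x).1 hx⟩, rfl⟩
    · rintro ⟨e, ⟨he, hx⟩, rfl⟩
      exact ⟨mapEdge_mem_edgeSet hφ he, (mem_mapEdge x).2 hx⟩
  rw [degree, himage, (mapEdge_injOn.mono fun e he => he.1).ncard_image, degree]

end Isomorphism

theorem eq_refl_of_mapEdge_eq {φ : V(H) ≃ V(H)}
    (htwins : ∀ x ∈ V(H), ∀ y ∈ V(H), AreTwins H x y → x = y)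
    (hφ : ∀ e ∈ E(H), mapEdge φ e = e) : φ = Equiv.refl _ := by
  ext x
  refine htwins _ (φ x).2 _ x.2 fun e he => ?_
  conv_lhs => rw [← hφ e he]
  exact mem_mapEdge x

end Hypergraphs

/-! ### The edges of `G_{k,s}` at a given copy -/

/-- The number `m` such that `p` is a copy of `G_m` or, for `p = []`, of `G*_m`. -/
def copySize (k s : ℕ) (p : List ℕ) : ℕ := if p.length = s + 1 then k else k - 2

/-- The pair `(p, i)` is a valid index of an edge `layeredEdge k s p i` of `G_{k,s}`: the copy `p`
exists and its block has an edge number `i`. -/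
def IsEdgeIndex (k s : ℕ) (p : List ℕ) (i : ℕ) : Prop :=
  IsCopy k s p ∧ 1 ≤ i ∧ i ≤ copyNumEdges k s p

/-- The edge through which the copy `p` is linked to the rest of `G_{k,s}`: the enlarged edge of
the copy above to which `p` is attached. For the top copy, to which no edge above corresponds, it
is the edge `M*`, so that in all cases it is the only edge that meets the copy `p` apart from the
enlarged edges `M_1, …, M_m` of `p`. -/
def linkEdge (k s : ℕ) : List ℕ → Set (List ℕ × ℕ)
  | [] => layeredEdge k s [] (k - 1)
  | i :: p => layeredEdge k s p i

section Copies

variable {k s : ℕ} {p q r : List ℕ} {a b i j : ℕ}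

theorem four_le_copySize (hk : 6 ≤ k) (s : ℕ) (p : List ℕ) : 4 ≤ copySize k s p := by
  unfold copySize
  split_ifs <;> omega

theorem sub_two_le_copySize : k - 2 ≤ copySize k s p := by
  unfold copySize
  split_ifs <;> omega

theorem copySize_nil : copySize k s [] = k - 2 := by
  simp [copySize]

theorem copyNumEdges_congr (h : p.length = q.length) :
    copyNumEdges k s p = copyNumEdges k s q := by
  simp [copyNumEdges, ← List.length_eq_zero_iff, h]

theorem copyEdge_congr (h : p.length = q.length) : copyEdge k s p i = copyEdge k s q i := by
  simp [copyEdge, ← List.length_eq_zero_iff, h]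

theorem copyLastTwo_congr (h : p.length = q.length) :
    copyLastTwo k s p = copyLastTwo k s q := by
  simp [copyLastTwo, h]

theorem mem_copyVerts :
    j ∈ copyVerts k s p ↔ p = [] ∧ j = 0 ∨ 1 ≤ j ∧ j ≤ 2 * copySize k s p - 1 := by
  unfold copyVerts copySize starVerts blockVerts
  split_ifs <;> simp_all

theorem mem_copyEdge (hi : 1 ≤ i) (him : i ≤ copySize k s p) :
    j ∈ copyEdge k s p i ↔ i ≤ j ∧ j < i + copySize k s p := by
  unfold copyEdge copySize starEdge blockEdge at *
  split_ifs at * <;> grind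

theorem mem_copyEdge_star (hk : 6 ≤ k) :
    j ∈ copyEdge k s [] (k - 1) ↔ j = 0 ∨ j = k ∨ 1 ≤ j ∧ j ≤ k - 4 := by
  have hnum : k - 1 = k - 2 + 1 := by omega
  have hvert : k - 2 + 2 = k := by omega
  simp [copyEdge, starEdge, hnum, hvert, Nat.sub_sub]

theorem mem_copyLastTwo :
    j ∈ copyLastTwo k s p ↔ j = 2 * copySize k s p - 2 ∨ j = 2 * copySize k s p - 1 := by
  unfold copyLastTwo copySize
  split_ifs <;> simp

theorem IsEdgeIndex.le_copySize_or (h : IsEdgeIndex k s p i) :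
    i ≤ copySize k s p ∨ p = [] ∧ i = k - 1 := by
  obtain ⟨-, -, hi⟩ := h
  unfold copyNumEdges at hi
  unfold copySize
  grind

theorem isEdgeIndex_of_le_copySize (hp : IsCopy k s p) (hi : 1 ≤ i) (him : i ≤ copySize k s p) :
    IsEdgeIndex k s p i := by
  refine ⟨hp, hi, him.trans ?_⟩
  unfold copySize copyNumEdges
  grind

theorem isEdgeIndex_star (hk : 6 ≤ k) : IsEdgeIndex k s [] (k - 1) :=
  ⟨.nil, by omega, by simp [copyNumEdges]⟩

theorem isCopy_cons_iff :
    IsCopy k s (i :: p) ↔ IsEdgeIndex k s p i ∧ p.length ≠ s + 1 := by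
  constructor
  · rintro (_ | ⟨_, _, hp, hl, hi, hi'⟩)
    exact ⟨⟨hp, hi, hi'⟩, by omega⟩
  · rintro ⟨⟨hp, hi, hi'⟩, hl⟩
    exact .cons i p hp (by have := hp.length_le; omega) hi hi'

theorem isCopy_of_append (h : IsCopy k s (r ++ p)) : IsCopy k s p := by
  induction r with
  | nil => exact h
  | cons a r ih => exact ih (isCopy_cons_iff.1 h).1.1

theorem isEdgeIndex_of_append (h : IsCopy k s (r ++ a :: p)) : IsEdgeIndex k s p a :=
  (isCopy_cons_iff.1 (isCopy_of_append h)).1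

theorem isCopy_append_congr (h : IsCopy k s (r ++ a :: p)) (hb : IsEdgeIndex k s p b) :
    IsCopy k s (r ++ b :: p) := by
  induction r with
  | nil => exact isCopy_cons_iff.2 ⟨hb, (isCopy_cons_iff.1 h).2⟩
  | cons c r ih =>
    obtain ⟨⟨hr, hc, hc'⟩, hl⟩ := isCopy_cons_iff.1 h
    have hlen : (r ++ a :: p).length = (r ++ b :: p).length := by simp
    exact isCopy_cons_iff.2 ⟨⟨ih hr, hc, copyNumEdges_congr hlen ▸ hc'⟩, hlen ▸ hl⟩

theorem isEdgeIndex_append_congr (h : IsEdgeIndex k s (r ++ a :: p) i)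
    (hb : IsEdgeIndex k s p b) : IsEdgeIndex k s (r ++ b :: p) i := by
  obtain ⟨hr, hi, hi'⟩ := h
  have hlen : (r ++ a :: p).length = (r ++ b :: p).length := by simp
  exact ⟨isCopy_append_congr hr hb, hi, copyNumEdges_congr hlen ▸ hi'⟩

theorem mem_layeredEdge :
    (q, j) ∈ layeredEdge k s p i ↔ q = p ∧ j ∈ copyEdge k s p i ∨
      p.length ≠ s + 1 ∧ q = i :: p ∧ j ∈ copyLastTwo k s (i :: p) := by
  unfold layeredEdge
  split_ifs with h <;> simp [h, eq_comm, and_comm]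

theorem mem_layeredEdge_self : (p, j) ∈ layeredEdge k s p i ↔ j ∈ copyEdge k s p i := by
  simp [mem_layeredEdge]

theorem mem_linkEdge_nil (hk : 6 ≤ k) :
    ([], j) ∈ linkEdge k s [] ↔ j = 0 ∨ j = k ∨ 1 ≤ j ∧ j ≤ k - 4 :=
  mem_layeredEdge_self.trans (mem_copyEdge_star hk)

theorem mem_linkEdge_cons (h : IsCopy k s (i :: p)) :
    (i :: p, j) ∈ linkEdge k s (i :: p) ↔
      j = 2 * copySize k s (i :: p) - 2 ∨ j = 2 * copySize k s (i :: p) - 1 := by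
  have hl := (isCopy_cons_iff.1 h).2
  simp [linkEdge, mem_layeredEdge, mem_copyLastTwo, hl]

theorem layeredEdge_eq_linkEdge_or (hp : IsEdgeIndex k s p i)
    (hq : (q, j) ∈ layeredEdge k s p i) :
    layeredEdge k s p i = linkEdge k s q ∨
      p = q ∧ i ≤ copySize k s q ∧ i ≤ j ∧ j < i + copySize k s q := by
  rcases mem_layeredEdge.1 hq with ⟨rfl, hj⟩ | ⟨-, rfl, -⟩
  · rcases hp.le_copySize_or with him | ⟨rfl, rfl⟩
    · exact .inr ⟨rfl, him, (mem_copyEdge hp.2.1 him).1 hj⟩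
    · exact .inl rfl
  · exact .inl rfl

section Layered

variable (hk : 6 ≤ k)

theorem mem_vertexSet_layered :
    (p, j) ∈ V(layered k s hk) ↔
      IsCopy k s p ∧ (p = [] ∧ j = 0 ∨ 1 ≤ j ∧ j ≤ 2 * copySize k s p - 1) :=
  and_congr_right fun _ => mem_copyVerts

theorem mem_edgeSet_layered {e : Set (List ℕ × ℕ)} :
    e ∈ E(layered k s hk) ↔ ∃ p i, IsEdgeIndex k s p i ∧ e = layeredEdge k s p i := by
  simp [layered, IsEdgeIndex, and_assoc]

theorem layeredEdge_mem_edgeSet (h : IsEdgeIndex k s p i) :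
    layeredEdge k s p i ∈ E(layered k s hk) :=
  (mem_edgeSet_layered hk).2 ⟨p, i, h, rfl⟩

theorem linkEdge_mem_edgeSet (hp : IsCopy k s p) : linkEdge k s p ∈ E(layered k s hk) := by
  cases p with
  | nil => exact layeredEdge_mem_edgeSet hk (isEdgeIndex_star hk)
  | cons i p => exact layeredEdge_mem_edgeSet hk (isCopy_cons_iff.1 hp).1

theorem exists_mem_copyEdge (h : (p, j) ∈ V(layered k s hk)) :
    ∃ i, IsEdgeIndex k s p i ∧ j ∈ copyEdge k s p i := by
  obtain ⟨hp, ⟨rfl, rfl⟩ | ⟨hj, hj'⟩⟩ := (mem_vertexSet_layered hk).1 h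
  · exact ⟨k - 1, isEdgeIndex_star hk, (mem_copyEdge_star hk).2 (.inl rfl)⟩
  have h4 := four_le_copySize hk s p
  by_cases hjm : j ≤ copySize k s p
  · exact ⟨j, isEdgeIndex_of_le_copySize hp hj hjm, (mem_copyEdge hj hjm).2 (by omega)⟩
  · exact ⟨copySize k s p, isEdgeIndex_of_le_copySize hp (by omega) le_rfl,
      (mem_copyEdge (by omega) le_rfl).2 (by omega)⟩

end Layered

end Copies

/-! ### Permuting the copies below a copy -/

/-- The permutation of the indices of the copies that sends the copies below and including the
`a`-th child `a :: p` of `p` to the corresponding copies below `σ a :: p`, for all `a`. -/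
def permuteChildren {α : Type*} [DecidableEq α] (p : List α) (σ : α → α) : List α → List α
  | [] => []
  | a :: t => if t = p then σ a :: t else a :: permuteChildren p σ t

section PermuteChildren

variable {α : Type*} [DecidableEq α] {p : List α} {σ : α → α}

theorem length_permuteChildren (t : List α) : (permuteChildren p σ t).length = t.length := by
  induction t with
  | nil => rfl
  | cons a t ih =>
    unfold permuteChildren
    split_ifs
    · rfl
    · rw [List.length_cons, ih, List.length_cons]

theorem permuteChildren_of_length_le {t : List α} (h : t.length ≤ p.length) :
    permuteChildren p σ t = t := by
  induction t with
  | nil => rfl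
  | cons a t ih =>
    have hlt : t.length < p.length := h
    have hne : t ≠ p := by rintro rfl; exact hlt.false
    rw [permuteChildren, if_neg hne, ih hlt.le]

theorem permuteChildren_self : permuteChildren p σ p = p := permuteChildren_of_length_le le_rfl

theorem permuteChildren_cons_self (a : α) : permuteChildren p σ (a :: p) = σ a :: p :=
  if_pos rfl

theorem permuteChildren_append (r : List α) (a : α) :
    permuteChildren p σ (r ++ a :: p) = r ++ σ a :: p := by
  induction r with
  | nil => exact permuteChildren_cons_self a
  | cons b r ih =>
    have hne : r ++ a :: p ≠ p := fun h => by
      have hlen := congrArg List.length h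
      rw [List.length_append, List.length_cons] at hlen
      omega
    rw [List.cons_append, permuteChildren, if_neg hne, ih, List.cons_append]

theorem permuteChildren_eq_self_or (t : List α) :
    permuteChildren p σ t = t ∨ ∃ r a, t = r ++ a :: p := by
  induction t with
  | nil => exact .inl rfl
  | cons b t ih =>
    by_cases h : t = p
    · exact .inr ⟨[], b, by rw [h, List.nil_append]⟩
    · rcases ih with ih | ⟨r, a, rfl⟩
      · exact .inl (by rw [permuteChildren, if_neg h, ih])
      · exact .inr ⟨b :: r, a, rfl⟩

theorem permuteChildren_involutive (hσ : Function.Involutive σ) :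
    Function.Involutive (permuteChildren p σ) := by
  intro t
  rcases permuteChildren_eq_self_or (p := p) (σ := σ) t with h | ⟨r, a, rfl⟩
  · rw [h, h]
  · rw [permuteChildren_append, permuteChildren_append, hσ]

theorem permuteChildren_eq_self_iff (hσ : Function.Involutive σ) {t : List α} :
    permuteChildren p σ t = p ↔ t = p := by
  rw [(permuteChildren_involutive hσ).eq_iff, permuteChildren_self]

end PermuteChildren

/-- The map that acts as `τ` on the vertices of the copy `p` and moves the copies below `p` as
`σ` moves the edge numbers of `p`. -/
def blockMap (p : List ℕ) (σ τ : ℕ → ℕ) (x : List ℕ × ℕ) : List ℕ × ℕ :=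
  (permuteChildren p σ x.1, if x.1 = p then τ x.2 else x.2)

section BlockMap

variable {k s i : ℕ} {p t : List ℕ} {σ τ : ℕ → ℕ}

theorem blockMap_self (j : ℕ) : blockMap p σ τ (p, j) = (p, τ j) := by
  rw [blockMap, permuteChildren_self, if_pos rfl]

theorem blockMap_of_ne {q : List ℕ} (hq : q ≠ p) (j : ℕ) :
    blockMap p σ τ (q, j) = (permuteChildren p σ q, j) := by
  rw [blockMap, if_neg hq]

theorem blockMap_involutive (hσ : Function.Involutive σ) (hτ : Function.Involutive τ) :
    Function.Involutive (blockMap p σ τ) := by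
  rintro ⟨q, j⟩
  by_cases hq : q = p
  · rw [hq, blockMap_self, blockMap_self, hτ]
  · rw [blockMap_of_ne hq, blockMap_of_ne (mt (permuteChildren_eq_self_iff hσ).1 hq),
      permuteChildren_involutive hσ]

theorem blockMap_image_layeredEdge_self (hσ : Function.Involutive σ)
    (hτ : Function.Involutive τ)
    (hE : ∀ j, j ∈ copyEdge k s p i ↔ τ j ∈ copyEdge k s p (σ i)) :
    blockMap p σ τ '' layeredEdge k s p i = layeredEdge k s p (σ i) := by
  have hinv := blockMap_involutive (p := p) hσ hτ
  rw [Set.image_eq_preimage_of_inverse hinv hinv]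
  ext ⟨q, j⟩
  rw [Set.mem_preimage]
  by_cases hq : q = p
  · rw [hq, blockMap_self, mem_layeredEdge_self, mem_layeredEdge_self, hE, hτ]
  · rw [blockMap_of_ne hq, mem_layeredEdge, mem_layeredEdge, permuteChildren_eq_self_iff hσ,
      (permuteChildren_involutive hσ).eq_iff, permuteChildren_cons_self,
      copyLastTwo_congr (p := i :: p) (q := σ i :: p) rfl]
    simp only [hq, false_and]

theorem blockMap_image_layeredEdge_of_ne (hσ : Function.Involutive σ)
    (hτ : Function.Involutive τ) (htp : t ≠ p) (hcons : i :: t ≠ p) :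
    blockMap p σ τ '' layeredEdge k s t i = layeredEdge k s (permuteChildren p σ t) i := by
  have hinv := blockMap_involutive (p := p) hσ hτ
  have hchild : permuteChildren p σ (i :: t) = i :: permuteChildren p σ t := if_neg htp
  rw [Set.image_eq_preimage_of_inverse hinv hinv]
  ext ⟨q, j⟩
  rw [Set.mem_preimage]
  by_cases hq : q = p
  · subst hq
    have hchild' : q ≠ i :: permuteChildren q σ t := by
      rwa [← hchild, ne_comm, Ne, permuteChildren_eq_self_iff hσ]
    have hself : q ≠ permuteChildren q σ t := by
      rwa [ne_comm, Ne, permuteChildren_eq_self_iff hσ]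
    simp only [blockMap_self, mem_layeredEdge, htp.symm, hcons.symm, hchild', hself, false_and,
      and_false]
  · rw [blockMap_of_ne hq, mem_layeredEdge, mem_layeredEdge,
      (permuteChildren_involutive hσ).eq_iff, (permuteChildren_involutive hσ).eq_iff, hchild,
      length_permuteChildren, copyEdge_congr (length_permuteChildren t),
      copyLastTwo_congr (p := i :: permuteChildren p σ t) (q := i :: t)
        (by rw [List.length_cons, length_permuteChildren, List.length_cons])]

end BlockMap

/-! ### Subhypergraphs without an involution -/

/-- The edge number `i` of the copy `p` of `G_{k,s}` exists and belongs to `H`. -/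
def HasEdge (H : Hypergraph (List ℕ × ℕ)) (k s : ℕ) (p : List ℕ) (i : ℕ) : Prop :=
  IsEdgeIndex k s p i ∧ layeredEdge k s p i ∈ E(H)

/-- `H` contains all or none of the edges that hang below an edge of the copy `p`, according to
whether it contains that edge. The list `r ++ i :: p` runs over the copies below the edge number
`i` of `p`. -/
def IsUniformBelow (H : Hypergraph (List ℕ × ℕ)) (k s : ℕ) (p : List ℕ) : Prop :=
  ∀ r i a, IsEdgeIndex k s (r ++ i :: p) a → (HasEdge H k s (r ++ i :: p) a ↔ HasEdge H k s p i)

/-- The reversal `j ↦ n + 1 - j` of `{1, …, n}`, extended by the identity. -/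
def reflect (n j : ℕ) : ℕ := if 1 ≤ j ∧ j ≤ n then n + 1 - j else j

theorem reflect_involutive (n : ℕ) : Function.Involutive (reflect n) := by
  intro j
  unfold reflect
  split_ifs <;> omega

section Subhypergraph

variable {k s : ℕ} {H : Hypergraph (List ℕ × ℕ)} {p : List ℕ} {c i j : ℕ}

theorem mem_copyEdge_reflect (hi : 1 ≤ i) (him : i ≤ copySize k s p) :
    j ∈ copyEdge k s p i ↔
      reflect (2 * copySize k s p - 1) j ∈ copyEdge k s p (reflect (copySize k s p) i) := by
  have hreflect : reflect (copySize k s p) i = copySize k s p + 1 - i := if_pos ⟨hi, him⟩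
  rw [hreflect, mem_copyEdge hi him, mem_copyEdge (by omega) (by omega)]
  unfold reflect
  split_ifs <;> omega

theorem HasEdge.mem_vertexSet (h : HasEdge H k s p i) (hj : j ∈ copyEdge k s p i) :
    (p, j) ∈ V(H) :=
  mem_vertexSet_of_mem_edgeSet h.2 (mem_layeredEdge_self.2 hj)

theorem HasEdge.mem_vertexSet_of_le (h : HasEdge H k s p i) (him : i ≤ copySize k s p)
    (hij : i ≤ j) (hj : j < i + copySize k s p) : (p, j) ∈ V(H) :=
  h.mem_vertexSet ((mem_copyEdge h.1.2.1 him).2 ⟨hij, hj⟩)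

variable {hk : 6 ≤ k} (hH : IsSubhypergraph H (layered k s hk))

include hH

theorem exists_hasEdge {e : Set (List ℕ × ℕ)} (he : e ∈ E(H)) :
    ∃ p i, HasEdge H k s p i ∧ e = layeredEdge k s p i := by
  obtain ⟨p, i, hpi, rfl⟩ := (mem_edgeSet_layered hk).1 (hH.2 he)
  exact ⟨p, i, ⟨hpi, he⟩, rfl⟩

theorem hasInvolution_of_blockMap {σ τ : ℕ → ℕ} (hσ : Function.Involutive σ)
    (hτ : Function.Involutive τ) (hbelow : IsUniformBelow H k s p)
    (hE : ∀ i, HasEdge H k s p i →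
      HasEdge H k s p (σ i) ∧ ∀ j, j ∈ copyEdge k s p i ↔ τ j ∈ copyEdge k s p (σ i))
    (hup : ∀ t i, HasEdge H k s t i → i :: t ≠ p) (hi : HasEdge H k s p i)
    (hj : j ∈ copyEdge k s p i) (hτj : τ j ≠ j) : HasInvolution H := by
  have hmoved : blockMap p σ τ (p, j) ≠ (p, j) := by
    rw [blockMap_self]
    exact fun h => hτj (congrArg Prod.snd h)
  refine hasInvolution_of_image_mem_edgeSet (blockMap_involutive (p := p) hσ hτ) (fun e he => ?_)
    hi.2 (mem_layeredEdge_self.2 hj) hmoved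
  obtain ⟨t, a, ha, rfl⟩ := exists_hasEdge hH he
  by_cases htp : t = p
  · subst htp
    rw [blockMap_image_layeredEdge_self hσ hτ (hE a ha).2]
    exact (hE a ha).1.2
  rw [blockMap_image_layeredEdge_of_ne hσ hτ htp (hup t a ha)]
  rcases permuteChildren_eq_self_or (p := p) (σ := σ) t with ht | ⟨r, b, rfl⟩
  · rwa [ht]
  · have hσb : HasEdge H k s p (σ b) := (hE b ((hbelow r b a ha.1).1 ha)).1
    rw [permuteChildren_append]
    exact ((hbelow r (σ b) a (isEdgeIndex_append_congr ha.1 hσb.1)).2 hσb).2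

theorem hasInvolution_of_reflect (hbelow : IsUniformBelow H k s p)
    (hall : ∀ i, 1 ≤ i → i ≤ copySize k s p → HasEdge H k s p i)
    (hlink : linkEdge k s p ∉ E(H)) : HasInvolution H := by
  have h4 := four_le_copySize hk s p
  refine hasInvolution_of_blockMap hH (reflect_involutive (copySize k s p))
    (reflect_involutive (2 * copySize k s p - 1)) hbelow (fun i hi => ?_) ?_
    (hall 1 le_rfl (by omega)) (j := 1) ((mem_copyEdge le_rfl (by omega)).2 (by omega)) ?_
  · rcases hi.1.le_copySize_or with him | ⟨rfl, rfl⟩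
    · refine ⟨hall _ ?_ ?_, fun j => mem_copyEdge_reflect hi.1.2.1 him⟩ <;>
      have := hi.1.2.1 <;> unfold reflect <;> split_ifs <;> omega
    · exact (hlink hi.2).elim
  · rintro t i hi rfl
    exact hlink hi.2
  · unfold reflect
    split_ifs <;> omega

variable (hinv : ¬ HasInvolution H)

include hinv

theorem exists_separating_hasEdge {j' : ℕ} (hne : j ≠ j') (hj : (p, j) ∈ V(H))
    (hj' : (p, j') ∈ V(H))
    (hlink : linkEdge k s p ∈ E(H) → ((p, j) ∈ linkEdge k s p ↔ (p, j') ∈ linkEdge k s p)) :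
    ∃ i, HasEdge H k s p i ∧ i ≤ copySize k s p ∧
      ¬ (i ≤ j ∧ j < i + copySize k s p ↔ i ≤ j' ∧ j' < i + copySize k s p) := by
  by_contra! hsep
  have hmem : ∀ t i, HasEdge H k s t i →
      ((p, j) ∈ layeredEdge k s t i ∨ (p, j') ∈ layeredEdge k s t i) →
      ((p, j) ∈ layeredEdge k s t i ↔ (p, j') ∈ layeredEdge k s t i) := by
    rintro t i hi hor
    obtain heq | ⟨rfl, him⟩ : layeredEdge k s t i = linkEdge k s p ∨
        t = p ∧ i ≤ copySize k s p := by
      rcases hor with h | h <;> rcases layeredEdge_eq_linkEdge_or hi.1 h with h | h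
      exacts [.inl h, .inr ⟨h.1, h.2.1⟩, .inl h, .inr ⟨h.1, h.2.1⟩]
    · rw [heq]
      exact hlink (heq ▸ hi.2)
    · rw [mem_layeredEdge_self, mem_layeredEdge_self, mem_copyEdge hi.1.2.1 him,
        mem_copyEdge hi.1.2.1 him]
      exact hsep i hi him
  refine hinv (hasInvolution_of_areTwins (x := (p, j)) (y := (p, j')) (by simpa using hne) hj hj'
    fun e he => ?_)
  obtain ⟨t, i, hi, rfl⟩ := exists_hasEdge hH he
  exact ⟨fun h => (hmem t i hi (.inl h)).1 h, fun h => (hmem t i hi (.inr h)).2 h⟩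

theorem hasEdge_one_of_hasEdge_cons (h : HasEdge H k s (c :: p) i) :
    HasEdge H k s (c :: p) 1 := by
  have h4 := four_le_copySize hk s (c :: p)
  have him := h.1.le_copySize_or.resolve_right (by simp)
  by_cases hi : i = 1
  · rwa [← hi]
  have hi1 := h.1.2.1
  have hmem : ∀ j, i ≤ j → j < i + copySize k s (c :: p) → (c :: p, j) ∈ V(H) :=
    fun j => h.mem_vertexSet_of_le him
  obtain ⟨a, ha, ham, hsep⟩ := exists_separating_hasEdge hH hinv
    (j := copySize k s (c :: p)) (j' := copySize k s (c :: p) + 1) (by omega)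
    (hmem _ (by omega) (by omega)) (hmem _ (by omega) (by omega)) fun _ => by
      rw [mem_linkEdge_cons h.1.1, mem_linkEdge_cons h.1.1]
      omega
  have ha1 := ha.1.2.1
  obtain rfl : a = 1 := by omega
  exact ha

theorem hasEdge_cons_of_hasEdge_cons {a : ℕ} (h : HasEdge H k s (c :: p) a)
    (hi : IsEdgeIndex k s (c :: p) i) : HasEdge H k s (c :: p) i := by
  have h4 := four_le_copySize hk s (c :: p)
  have him := hi.le_copySize_or.resolve_right (by simp)
  have hone := hasEdge_one_of_hasEdge_cons hH hinv h
  by_cases hi1 : i = 1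
  · rwa [hi1]
  have hi' := hi.2.1
  have hmem : ∀ j, 1 ≤ j → j < 1 + copySize k s (c :: p) → (c :: p, j) ∈ V(H) :=
    fun j => hone.mem_vertexSet_of_le (by omega)
  obtain ⟨b, hb, -, hsep⟩ := exists_separating_hasEdge hH hinv (j := i - 1) (j' := i)
    (by omega) (hmem _ (by omega) (by omega)) (hmem _ (by omega) (by omega)) fun _ => by
      rw [mem_linkEdge_cons h.1.1, mem_linkEdge_cons h.1.1]
      omega
  have hb1 := hb.1.2.1
  obtain rfl : b = i := by omega
  exact hb

theorem hasEdge_of_hasEdge_cons (hbelow : IsUniformBelow H k s (c :: p))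
    (h : HasEdge H k s (c :: p) i) : HasEdge H k s p c := by
  by_contra hc
  have hcopy := h.1.1
  refine hinv (hasInvolution_of_reflect hH hbelow (fun a ha ham =>
    hasEdge_cons_of_hasEdge_cons hH hinv h (isEdgeIndex_of_le_copySize hcopy ha ham))
    fun hlink => hc ⟨(isCopy_cons_iff.1 hcopy).1, hlink⟩)

theorem hasEdge_cons_of_hasEdge (hc : HasEdge H k s p c) (hi : IsEdgeIndex k s (c :: p) i) :
    HasEdge H k s (c :: p) i := by
  have h4 := four_le_copySize hk s (c :: p)
  have hmem : ∀ j, (c :: p, j) ∈ linkEdge k s (c :: p) → (c :: p, j) ∈ V(H) :=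
    fun j => mem_vertexSet_of_mem_edgeSet hc.2
  simp only [mem_linkEdge_cons hi.1] at hmem
  obtain ⟨a, ha, -⟩ := exists_separating_hasEdge hH hinv (p := c :: p)
    (j := 2 * copySize k s (c :: p) - 2) (j' := 2 * copySize k s (c :: p) - 1) (by omega)
    (hmem _ (.inl rfl)) (hmem _ (.inr rfl)) fun _ => by
      simp only [mem_linkEdge_cons hi.1, true_or, or_true]
  exact hasEdge_cons_of_hasEdge_cons hH hinv ha hi

theorem isUniformBelow (p : List ℕ) : IsUniformBelow H k s p := by
  induction hn : s + 1 - p.length generalizing p with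
  | zero =>
    intro r i a h
    have hlen := h.1.length_le
    simp only [List.length_append, List.length_cons] at hlen
    omega
  | succ n ih =>
    intro r i a h
    have hbelow : IsUniformBelow H k s (i :: p) := ih (i :: p) (by rw [List.length_cons]; omega)
    have hchild : ∀ b, IsEdgeIndex k s (i :: p) b →
        (HasEdge H k s (i :: p) b ↔ HasEdge H k s p i) := fun b hb =>
      ⟨hasEdge_of_hasEdge_cons hH hinv hbelow, fun hi => hasEdge_cons_of_hasEdge hH hinv hi hb⟩
    rcases r.eq_nil_or_concat with rfl | ⟨r, b, rfl⟩
    · exact hchild a h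
    · rw [List.concat_eq_append, List.append_assoc, List.singleton_append] at h ⊢
      rw [hbelow r b a h, hchild b (isEdgeIndex_of_append h.1)]

end Subhypergraph

/-- For `k = 6`, the action of `exceptionalSwap` on the edges of the top copy other than `M_3`. -/
def exceptionalEdgeSwap : ℕ → ℕ
  | 1 => 2
  | 2 => 1
  | 4 => 5
  | 5 => 4
  | i => i

/-- The involution of `G*_4` without the edge `M_3`: it exchanges `M_1 = {1, 2, 3, 4}` with
`M_2 = {2, 3, 4, 5}` and `M_4 = {4, 5, 6, 7}` with `M* = {0, 1, 2, 6}`. -/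
def exceptionalSwap : ℕ → ℕ
  | 0 => 7
  | 1 => 5
  | 2 => 4
  | 4 => 2
  | 5 => 1
  | 7 => 0
  | j => j

theorem exceptionalEdgeSwap_involutive : Function.Involutive exceptionalEdgeSwap := by
  intro i
  unfold exceptionalEdgeSwap
  grind

theorem exceptionalSwap_involutive : Function.Involutive exceptionalSwap := by
  intro j
  unfold exceptionalSwap
  grind

theorem mem_copyEdge_exceptionalSwap {s i j : ℕ} (hi : IsEdgeIndex 6 s [] i) (hi3 : i ≠ 3) :
    j ∈ copyEdge 6 s [] i ↔ exceptionalSwap j ∈ copyEdge 6 s [] (exceptionalEdgeSwap i) := by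
  obtain ⟨-, hi1, hi5⟩ := hi
  simp only [copyNumEdges, if_true] at hi5
  unfold exceptionalSwap
  interval_cases i <;> simp [exceptionalEdgeSwap, copyEdge, starEdge, blockEdge] at * <;>
    grind

section TopCopy

variable {k s : ℕ} {H : Hypergraph (List ℕ × ℕ)} {hk : 6 ≤ k} {i j : ℕ}
  (hH : IsSubhypergraph H (layered k s hk)) (hinv : ¬ HasInvolution H)

include hH hinv

theorem eq_layered_of_hasEdge_nil (h : ∀ i, IsEdgeIndex k s [] i → HasEdge H k s [] i) :
    H = layered k s hk := by
  have hall : ∀ p i, IsEdgeIndex k s p i → HasEdge H k s p i := by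
    intro p i hpi
    rcases p.eq_nil_or_concat with rfl | ⟨r, c, rfl⟩
    · exact h i hpi
    · rw [List.concat_eq_append] at hpi ⊢
      exact (isUniformBelow hH hinv [] r c i hpi).2 (h c (isEdgeIndex_of_append hpi.1))
  refine Hypergraph.ext (hH.1.antisymm ?_) (hH.2.antisymm ?_)
  · rintro ⟨p, j⟩ hx
    obtain ⟨i, hpi, hj⟩ := exists_mem_copyEdge hk hx
    exact (hall p i hpi).mem_vertexSet hj
  · intro e he
    obtain ⟨p, i, hpi, rfl⟩ := (mem_edgeSet_layered hk).1 he
    exact (hall p i hpi).2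

theorem exists_hasEdge_nil (hcard : 2 ≤ V(H).ncard) : ∃ i, HasEdge H k s [] i := by
  by_contra! hnone
  obtain ⟨x, hx, y, hy, hxy⟩ := (Set.one_lt_ncard_iff_nontrivial_and_finite.1 hcard).1
  refine hinv (hasInvolution_of_areTwins hxy hx hy fun e he => ?_)
  obtain ⟨p, i, hpi, rfl⟩ := exists_hasEdge hH he
  rcases p.eq_nil_or_concat with rfl | ⟨r, c, rfl⟩
  · exact (hnone i hpi).elim
  · rw [List.concat_eq_append] at hpi
    exact (hnone c ((isUniformBelow hH hinv [] r c i hpi.1).1 hpi)).elim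

theorem hasEdge_nil_one (hcard : 2 ≤ V(H).ncard) : HasEdge H k s [] 1 := by
  obtain ⟨i, hi, him⟩ : ∃ i, HasEdge H k s [] i ∧ i ≤ copySize k s [] := by
    obtain ⟨i, hi⟩ := exists_hasEdge_nil hH hinv hcard
    rcases hi.1.le_copySize_or with him | ⟨-, rfl⟩
    · exact ⟨i, hi, him⟩
    · have hmem : ∀ j, 1 ≤ j → j ≤ k - 4 → ([], j) ∈ V(H) := fun j hj hj' =>
        hi.mem_vertexSet ((mem_copyEdge_star hk).2 (.inr (.inr ⟨hj, hj'⟩)))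
      obtain ⟨a, ha, ham, -⟩ := exists_separating_hasEdge hH hinv (j := 1) (j' := 2) (by omega)
        (hmem _ (by omega) (by omega)) (hmem _ (by omega) (by omega)) fun _ => by
          rw [mem_linkEdge_nil hk, mem_linkEdge_nil hk]
          omega
      exact ⟨a, ha, ham⟩
  by_cases hi1 : i = 1
  · rwa [← hi1]
  have hone := hi.1.2.1
  have hmem := fun j => hi.mem_vertexSet_of_le (j := j) him
  rw [copySize_nil] at him hmem
  obtain ⟨a, ha, ham, hsep⟩ := exists_separating_hasEdge hH hinv (j := k - 2) (j' := k - 1)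
    (by omega) (hmem _ (by omega) (by omega)) (hmem _ (by omega) (by omega)) fun _ => by
      rw [mem_linkEdge_nil hk, mem_linkEdge_nil hk]
      omega
  rw [copySize_nil] at ham hsep
  have ha1 := ha.1.2.1
  obtain rfl : a = 1 := by omega
  exact ha

theorem hasEdge_nil_of_le (hone : HasEdge H k s [] 1) (hi : 1 ≤ i) (hi' : i ≤ k - 2)
    (hlink : linkEdge k s [] ∈ E(H) → i ≠ k - 3) : HasEdge H k s [] i := by
  by_cases hi1 : i = 1
  · rwa [hi1]
  have hmem := fun j => hone.mem_vertexSet_of_le (j := j) (by rw [copySize_nil]; omega)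
  rw [copySize_nil] at hmem
  obtain ⟨a, ha, ham, hsep⟩ := exists_separating_hasEdge hH hinv (j := i - 1) (j' := i)
    (by omega) (hmem _ (by omega) (by omega)) (hmem _ (by omega) (by omega)) fun hstar => by
      have := hlink hstar
      rw [mem_linkEdge_nil hk, mem_linkEdge_nil hk]
      omega
  rw [copySize_nil] at ham hsep
  have ha1 := ha.1.2.1
  obtain rfl : a = i := by omega
  exact ha

theorem hasEdge_nil_sub_three (hk6 : k ≠ 6) (hlast : HasEdge H k s [] (k - 2)) :
    HasEdge H k s [] (k - 3) := by
  have hmem := fun j => hlast.mem_vertexSet_of_le (j := j) copySize_nil.ge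
  rw [copySize_nil] at hmem
  obtain ⟨a, ha, ham, hsep⟩ := exists_separating_hasEdge hH hinv
    (j := 2 * k - 6) (j' := 2 * k - 5) (by omega) (hmem _ (by omega) (by omega))
    (hmem _ (by omega) (by omega)) fun _ => by
      rw [mem_linkEdge_nil hk, mem_linkEdge_nil hk]
      omega
  rw [copySize_nil] at ham hsep
  have ha1 := ha.1.2.1
  obtain rfl : a = k - 3 := by omega
  exact ha

omit hinv in
theorem hasInvolution_of_exceptionalSwap (hk6 : k = 6) (hbelow : IsUniformBelow H k s [])
    (hall : ∀ i, IsEdgeIndex k s [] i → i ≠ 3 → HasEdge H k s [] i)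
    (hthree : ¬ HasEdge H k s [] 3) : HasInvolution H := by
  subst hk6
  refine hasInvolution_of_blockMap hH exceptionalEdgeSwap_involutive exceptionalSwap_involutive
    hbelow (fun i hi => ?_) (fun t i _ => List.cons_ne_nil i t)
    (hall 1 (isEdgeIndex_of_le_copySize .nil le_rfl (by rw [copySize_nil]; omega)) (by omega))
    (j := 1) ((mem_copyEdge le_rfl (by rw [copySize_nil]; omega)).2 (by rw [copySize_nil]; omega))
    (by decide)
  have hi3 : i ≠ 3 := by rintro rfl; exact hthree hi
  refine ⟨hall _ ⟨.nil, ?_⟩ ?_, fun j => mem_copyEdge_exceptionalSwap hi.1 hi3⟩ <;>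
    obtain ⟨⟨-, hi1, hi5⟩, -⟩ := hi <;> simp only [copyNumEdges, if_true] at hi5 ⊢ <;>
    interval_cases i <;> simp [exceptionalEdgeSwap] at *

theorem hasEdge_nil (hcard : 2 ≤ V(H).ncard) (hi : IsEdgeIndex k s [] i) : HasEdge H k s [] i := by
  have hbelow := isUniformBelow hH hinv []
  have hone := hasEdge_nil_one hH hinv hcard
  have hstar : HasEdge H k s [] (k - 1) := by
    by_contra hstar
    have hlink : linkEdge k s [] ∉ E(H) := fun h => hstar ⟨isEdgeIndex_star hk, h⟩
    exact hinv (hasInvolution_of_reflect hH hbelow (fun a ha ham =>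
      hasEdge_nil_of_le hH hinv hone ha (copySize_nil ▸ ham) (absurd · hlink)) hlink)
  have hall : ∀ a, IsEdgeIndex k s [] a → a ≠ k - 3 → HasEdge H k s [] a := by
    intro a ha hne
    rcases ha.le_copySize_or with ham | ⟨-, rfl⟩
    · exact hasEdge_nil_of_le hH hinv hone ha.2.1 (copySize_nil ▸ ham) fun _ => hne
    · exact hstar
  by_cases hi3 : i = k - 3
  · subst hi3
    by_cases hk6 : k = 6
    · subst hk6
      by_contra hthree
      exact hinv (hasInvolution_of_exceptionalSwap hH rfl hbelow hall hthree)
    · exact hasEdge_nil_sub_three hH hinv hk6 (hall _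
        (isEdgeIndex_of_le_copySize .nil (by omega) copySize_nil.ge) (by omega))
  · exact hall i hi hi3

theorem eq_layered_of_not_hasInvolution (hcard : 2 ≤ V(H).ncard) : H = layered k s hk :=
  eq_layered_of_hasEdge_nil hH hinv fun _ hi => hasEdge_nil hH hinv hcard hi

end TopCopy

/-! ### Numbers of vertices -/

section Cardinality

variable {k s : ℕ} {p : List ℕ} {i : ℕ}

theorem copyNumEdges_le : copyNumEdges k s p ≤ k := by
  unfold copyNumEdges
  split_ifs <;> omega

theorem finite_setOf_isCopy (k s : ℕ) : {p | IsCopy k s p}.Finite := by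
  have hlength : ∀ n, {p | IsCopy k s p ∧ p.length ≤ n}.Finite := by
    intro n
    induction n with
    | zero => exact (Set.finite_singleton []).subset fun p hp => by simpa using hp.2
    | succ n ih =>
      refine ((Set.Finite.image2 List.cons (Set.finite_Iic k) ih).insert []).subset ?_
      rintro (_ | ⟨a, p⟩) ⟨hp, hl⟩
      · exact .inl rfl
      · have ha := (isCopy_cons_iff.1 hp).1
        exact .inr ⟨a, ha.2.2.trans copyNumEdges_le, p, ⟨ha.1, by simpa using hl⟩, rfl⟩
  exact (hlength (s + 1)).subset fun p hp => ⟨hp, hp.length_le⟩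

theorem finite_vertexSet_layered (hk : 6 ≤ k) : V(layered k s hk).Finite := by
  refine ((finite_setOf_isCopy k s).prod (Set.finite_Iic (2 * k))).subset ?_
  rintro ⟨p, j⟩ hx
  obtain ⟨hp, hj⟩ := (mem_vertexSet_layered hk).1 hx
  refine ⟨hp, ?_⟩
  unfold copySize at hj
  split_ifs at hj <;> simp only [Set.mem_Iic] <;> omega

theorem finite_copyEdge : (copyEdge k s p i).Finite := by
  unfold copyEdge starEdge blockEdge
  split_ifs <;> simp [Set.finite_Icc]

theorem ncard_copyEdge (hk : 6 ≤ k) (h : IsEdgeIndex k s p i) :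
    (copyEdge k s p i).ncard = copySize k s p := by
  have h4 := four_le_copySize hk s p
  rcases h.le_copySize_or with him | ⟨rfl, rfl⟩
  · have hIcc : copyEdge k s p i = Set.Icc i (i + copySize k s p - 1) := by
      ext j
      rw [mem_copyEdge h.2.1 him, Set.mem_Icc]
      omega
    rw [hIcc, Set.ncard_Icc_nat]
    omega
  · have hinsert : copyEdge k s [] (k - 1) = insert 0 (insert k (Set.Icc 1 (k - 4))) := by
      ext j
      simp [mem_copyEdge_star hk]
    have hfin : (Set.Icc 1 (k - 4)).Finite := Set.finite_Icc _ _
    rw [hinsert, copySize_nil, Set.ncard_insert_of_notMem (by simp; omega) (hfin.insert k),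
      Set.ncard_insert_of_notMem (by simp; omega) hfin, Set.ncard_Icc_nat]
    omega

theorem ncard_copyLastTwo (hk : 6 ≤ k) : (copyLastTwo k s p).ncard = 2 := by
  unfold copyLastTwo
  split_ifs <;> exact Set.ncard_pair (by omega)

theorem ncard_layeredEdge (hk : 6 ≤ k) (h : IsEdgeIndex k s p i) :
    (layeredEdge k s p i).ncard = k := by
  have hcard (q : List ℕ) (S : Set ℕ) : (Prod.mk q '' S).ncard = S.ncard :=
    Set.ncard_image_of_injective _ (Prod.mk_right_injective q)
  unfold layeredEdge
  split_ifs with hl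
  · rw [Set.union_empty, hcard, ncard_copyEdge hk h, copySize, if_pos hl]
  · have hdisj : Disjoint (Prod.mk p '' copyEdge k s p i)
        (Prod.mk (i :: p) '' copyLastTwo k s (i :: p)) := by
      rw [Set.disjoint_left]
      rintro _ ⟨j, -, rfl⟩ ⟨j', -, h⟩
      exact List.cons_ne_self i p (congrArg Prod.fst h)
    have hfin : (copyLastTwo k s (i :: p)).Finite :=
      Set.finite_of_ncard_ne_zero (by rw [ncard_copyLastTwo hk]; omega)
    rw [Set.ncard_union_eq hdisj (finite_copyEdge.image _) (hfin.image _), hcard, hcard,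
      ncard_copyEdge hk h, ncard_copyLastTwo hk, copySize, if_neg hl]
    omega

theorem isKGraph_layered (hk : 6 ≤ k) : IsKGraph (layered k s hk) k := by
  refine ⟨finite_vertexSet_layered hk, fun e he => ?_⟩
  obtain ⟨p, i, h, rfl⟩ := (mem_edgeSet_layered hk).1 he
  exact ncard_layeredEdge hk h

/-- An injection of the vertices of `G_{k,s}` into those of `G_{k,s+1}`. A copy of `G_k` on layer
`1` has four vertices more than the copy of `G_{k-2}` with the same index in `G_{k,s+1}`; these are
put into a copy below. -/
def overflow (k s : ℕ) (x : List ℕ × ℕ) : List ℕ × ℕ :=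
  if x.1.length = s + 1 ∧ 2 * k - 5 < x.2 then (1 :: x.1, x.2 - (2 * k - 5)) else x

theorem overflow_injOn (hk : 6 ≤ k) : Set.InjOn (overflow k s) V(layered k s hk) := by
  rintro ⟨p, j⟩ hx ⟨q, l⟩ hy hxy
  have hp : p.length ≤ s + 1 := hx.1.length_le
  have hq : q.length ≤ s + 1 := hy.1.length_le
  have hlen := congrArg (fun x => x.1.length) hxy
  unfold overflow at hxy hlen
  split_ifs at hxy hlen <;>
    simp only [List.length_cons, Prod.mk.injEq, List.cons.injEq, true_and] at * <;>
    grind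

theorem isCopy_succ (h : IsCopy k s p) : IsCopy k (s + 1) p := by
  induction h with
  | nil => exact .nil
  | cons i p _ hl hi hi' ih =>
    refine .cons i p ih (by omega) hi (hi'.trans ?_)
    unfold copyNumEdges
    split_ifs <;> omega

theorem isCopy_one_cons (hk : 6 ≤ k) (hp : IsCopy k s p) (hl : p.length ≤ s) :
    IsCopy k s (1 :: p) := by
  have h4 := four_le_copySize hk s p
  exact isCopy_cons_iff.2 ⟨isEdgeIndex_of_le_copySize hp le_rfl (by omega), by omega⟩

theorem isCopy_replicate_one (hk : 6 ≤ k) {n : ℕ} (hn : n ≤ s + 1) :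
    IsCopy k s (List.replicate n 1) := by
  induction n with
  | zero => exact .nil
  | succ n ih => exact isCopy_one_cons hk (ih (by omega)) (by rw [List.length_replicate]; omega)

theorem overflow_mapsTo (hk : 6 ≤ k) :
    Set.MapsTo (overflow k s) V(layered k s hk) V(layered k (s + 1) hk) := by
  rintro ⟨p, j⟩ hx
  obtain ⟨hp, hj⟩ := (mem_vertexSet_layered hk).1 hx
  have hl := hp.length_le
  have h4 := four_le_copySize hk (s + 1) (1 :: p)
  simp only [overflow]
  split_ifs with h <;> rw [mem_vertexSet_layered]
  · refine ⟨isCopy_one_cons hk (isCopy_succ hp) hl, .inr ?_⟩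
    rw [copySize, if_pos h.1] at hj
    omega
  · refine ⟨isCopy_succ hp, hj.imp_right fun hj => ?_⟩
    unfold copySize at hj ⊢
    split_ifs at hj ⊢ <;> omega

theorem strictMono_ncard_vertexSet (hk : 6 ≤ k) :
    StrictMono fun s => V(layered k s hk).ncard := by
  refine strictMono_nat_of_lt_succ fun s => ?_
  rw [← (overflow_injOn hk).ncard_image]
  refine Set.ncard_lt_ncard ((Set.ssubset_iff_of_subset (overflow_mapsTo hk).image_subset).2
    ⟨(List.replicate (s + 2) 1, 5), ?_, ?_⟩) (finite_vertexSet_layered hk)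
  · have hsize := sub_two_le_copySize (k := k) (s := s + 1) (p := List.replicate (s + 2) 1)
    exact (mem_vertexSet_layered hk).2 ⟨isCopy_replicate_one hk le_rfl, .inr (by omega)⟩
  · rintro ⟨⟨p, j⟩, hx, hxy⟩
    obtain ⟨hp, hj⟩ := (mem_vertexSet_layered hk).1 hx
    have hl := hp.length_le
    have hlen := congrArg (fun x => x.1.length) hxy
    unfold overflow at hxy hlen
    split_ifs at hxy hlen with h <;>
      simp only [List.length_cons, List.length_replicate, Prod.mk.injEq] at h hxy hlen
    · rw [copySize, if_pos h.1] at hj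
      omega
    · omega

theorem not_isomorphic_layered {t : ℕ} (hk : 6 ≤ k) (hst : s ≠ t) :
    ¬ Isomorphic (layered k s hk) (layered k t hk) := by
  rintro ⟨φ, -⟩
  refine hst ((strictMono_ncard_vertexSet hk).injective ?_)
  simpa only [Nat.card_coe_set_eq] using Nat.card_congr φ

end Cardinality

/-! ### Automorphisms -/

/-- The edge `M_m` of the copy `p` of `G_m` or `G*_m`, from which an automorphism can recognise the
other edges `M_i` of that copy. -/
def lastEdge (k s : ℕ) (p : List ℕ) : Set (List ℕ × ℕ) := layeredEdge k s p (copySize k s p)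

section EdgesAndVertices

variable {k s : ℕ} {p q : List ℕ} {i j a b : ℕ} (hk : 6 ≤ k)

theorem eq_of_mem_layeredEdge (h : (p, j) ∈ layeredEdge k s q a)
    (h' : (q, b) ∈ layeredEdge k s p i) : p = q := by
  by_contra hpq
  have hp := congrArg List.length ((mem_layeredEdge.1 h).resolve_left fun h => hpq h.1).2.1
  have hq := congrArg List.length ((mem_layeredEdge.1 h').resolve_left fun h => hpq h.1.symm).2.1
  rw [List.length_cons] at hp hq
  omega

include hk

theorem exists_mem_layeredEdge_self (h : IsEdgeIndex k s p i) :
    ∃ j, (p, j) ∈ layeredEdge k s p i := by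
  have h4 := four_le_copySize hk s p
  obtain ⟨j, hj⟩ := Set.nonempty_of_ncard_ne_zero (s := copyEdge k s p i)
    (by rw [ncard_copyEdge hk h]; omega)
  exact ⟨j, mem_layeredEdge_self.2 hj⟩

theorem eq_of_copyEdge_eq (hi : IsEdgeIndex k s p i) (ha : IsEdgeIndex k s p a)
    (h : copyEdge k s p i = copyEdge k s p a) : i = a := by
  have h4 := four_le_copySize hk s p
  have hi1 := hi.2.1
  have ha1 := ha.2.1
  simp only [Set.ext_iff] at h
  rcases hi.le_copySize_or with him | ⟨rfl, rfl⟩ <;>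
    rcases ha.le_copySize_or with ham | ⟨hnil, rfl⟩
  · have hi' := h i
    have ha' := h a
    rw [mem_copyEdge hi1 him, mem_copyEdge ha1 ham] at hi' ha'
    omega
  · subst hnil
    have h0 := h 0
    rw [mem_copyEdge hi1 him, mem_copyEdge_star hk] at h0
    omega
  · have h0 := h 0
    rw [mem_copyEdge ha1 ham, mem_copyEdge_star hk] at h0
    omega
  · rfl

theorem layeredEdge_inj (hp : IsEdgeIndex k s p i) (hq : IsEdgeIndex k s q a) :
    layeredEdge k s p i = layeredEdge k s q a ↔ p = q ∧ i = a := by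
  refine ⟨fun h => ?_, by rintro ⟨rfl, rfl⟩; rfl⟩
  obtain ⟨j, hj⟩ := exists_mem_layeredEdge_self hk hp
  obtain ⟨b, hb⟩ := exists_mem_layeredEdge_self hk hq
  obtain rfl := eq_of_mem_layeredEdge (h ▸ hj) (h ▸ hb)
  refine ⟨rfl, eq_of_copyEdge_eq hk hp hq (Set.ext fun l => ?_)⟩
  rw [← mem_layeredEdge_self, h, mem_layeredEdge_self]

theorem exists_separating_copyEdge (hb : (p, b) ∈ V(layered k s hk)) (hjb : j < b) :
    ∃ i, IsEdgeIndex k s p i ∧ ¬ (j ∈ copyEdge k s p i ↔ b ∈ copyEdge k s p i) := by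
  have h4 := four_le_copySize hk s p
  obtain ⟨hp, hb'⟩ := (mem_vertexSet_layered hk).1 hb
  obtain ⟨i, hi, him, hsep⟩ : ∃ i, 1 ≤ i ∧ i ≤ copySize k s p ∧
      ¬ (i ≤ j ∧ j < i + copySize k s p ↔ i ≤ b ∧ b < i + copySize k s p) := by
    by_cases hbm : b ≤ copySize k s p
    · exact ⟨b, by omega, hbm, by omega⟩
    by_cases hjm : copySize k s p ≤ j
    · exact ⟨j + 1 - copySize k s p, by omega, by omega, by omega⟩
    · exact ⟨copySize k s p, by omega, le_rfl, by omega⟩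
  exact ⟨i, isEdgeIndex_of_le_copySize hp hi him,
    by rwa [mem_copyEdge hi him, mem_copyEdge hi him]⟩

theorem eq_of_areTwins {x y : List ℕ × ℕ} (hx : x ∈ V(layered k s hk))
    (hy : y ∈ V(layered k s hk)) (h : AreTwins (layered k s hk) x y) : x = y := by
  obtain ⟨p, j⟩ := x
  obtain ⟨q, b⟩ := y
  obtain rfl : p = q := by
    obtain ⟨i, hi, hj⟩ := exists_mem_copyEdge hk hx
    obtain ⟨a, ha, hb⟩ := exists_mem_copyEdge hk hy
    exact eq_of_mem_layeredEdge
      ((h _ (layeredEdge_mem_edgeSet hk ha)).2 (mem_layeredEdge_self.2 hb))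
      ((h _ (layeredEdge_mem_edgeSet hk hi)).1 (mem_layeredEdge_self.2 hj))
  have hiff : ∀ i, IsEdgeIndex k s p i → (j ∈ copyEdge k s p i ↔ b ∈ copyEdge k s p i) :=
    fun i hi => by
      rw [← mem_layeredEdge_self, ← mem_layeredEdge_self]
      exact h _ (layeredEdge_mem_edgeSet hk hi)
  rcases lt_trichotomy j b with hjb | rfl | hjb
  · obtain ⟨i, hi, hsep⟩ := exists_separating_copyEdge hk hy hjb
    exact (hsep (hiff i hi)).elim
  · rfl
  · obtain ⟨i, hi, hsep⟩ := exists_separating_copyEdge hk hx hjb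
    exact (hsep (hiff i hi).symm).elim

theorem isEdgeIndex_copySize (hp : IsCopy k s p) : IsEdgeIndex k s p (copySize k s p) :=
  isEdgeIndex_of_le_copySize hp (by have := four_le_copySize hk s p; omega) le_rfl

theorem mem_lastEdge_self :
    (p, j) ∈ lastEdge k s p ↔ copySize k s p ≤ j ∧ j < 2 * copySize k s p := by
  have h4 := four_le_copySize hk s p
  rw [lastEdge, mem_layeredEdge_self, mem_copyEdge (by omega) le_rfl]
  omega

theorem lastEdge_inter_linkEdge (h : IsCopy k s (i :: p)) :
    lastEdge k s (i :: p) ∩ linkEdge k s (i :: p) =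
      Prod.mk (i :: p) '' copyLastTwo k s (i :: p) := by
  have h4 := four_le_copySize hk s (i :: p)
  ext ⟨q, j⟩
  rw [Set.mem_inter_iff, Set.mem_image]
  constructor
  · rintro ⟨hlast, hlink⟩
    rcases mem_layeredEdge.1 hlink with ⟨rfl, -⟩ | ⟨-, rfl, hj⟩
    · have hlen := congrArg List.length
        ((mem_layeredEdge.1 hlast).resolve_left fun h => List.cons_ne_self i _ h.1.symm).2.1
      simp only [List.length_cons] at hlen
      omega
    · exact ⟨j, hj, rfl⟩
  · rintro ⟨l, hl, ⟨⟩⟩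
    rw [mem_linkEdge_cons h, ← mem_copyLastTwo, mem_lastEdge_self hk]
    refine ⟨?_, hl⟩
    rw [mem_copyLastTwo] at hl
    omega

theorem ncard_layeredEdge_inter_lastEdge (hi : 1 ≤ i) (him : i < copySize k s p) :
    (layeredEdge k s p i ∩ lastEdge k s p).ncard = i := by
  have hinter : layeredEdge k s p i ∩ lastEdge k s p =
      Prod.mk p '' Set.Icc (copySize k s p) (i + copySize k s p - 1) := by
    ext ⟨q, j⟩
    rw [Set.mem_inter_iff, Set.mem_image]
    constructor
    · rintro ⟨hi', hlast⟩
      obtain rfl : q = p := by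
        by_contra hqp
        have hq := ((mem_layeredEdge.1 hi').resolve_left fun h => hqp h.1).2.1
        have hq' := ((mem_layeredEdge.1 hlast).resolve_left fun h => hqp h.1).2.1
        exact him.ne (List.cons_eq_cons.1 (hq.symm.trans hq')).1
      rw [mem_layeredEdge_self, mem_copyEdge hi him.le] at hi'
      rw [mem_lastEdge_self hk] at hlast
      exact ⟨j, ⟨hlast.1, by omega⟩, rfl⟩
    · rintro ⟨l, ⟨hl, hl'⟩, ⟨⟩⟩
      rw [mem_layeredEdge_self, mem_copyEdge hi him.le, mem_lastEdge_self hk]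
      omega
  rw [hinter, Set.ncard_image_of_injective _ (Prod.mk_right_injective p), Set.ncard_Icc_nat]
  omega

end EdgesAndVertices

/-- The edges `M_i` of the copy `p` that contain its vertex `v_j`. -/
def ownEdges (k s : ℕ) (p : List ℕ) (j : ℕ) : Set (Set (List ℕ × ℕ)) :=
  layeredEdge k s p '' Set.Icc (max 1 (j + 1 - copySize k s p)) (min j (copySize k s p))

section Degrees

variable {k s : ℕ} {p : List ℕ} {i j : ℕ}

theorem finite_ownEdges (k s : ℕ) (p : List ℕ) (j : ℕ) : (ownEdges k s p j).Finite :=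
  (Set.finite_Icc _ _).image _

theorem ncard_ownEdges_le (k s : ℕ) (p : List ℕ) (j : ℕ) :
    (ownEdges k s p j).ncard ≤ min j (2 * copySize k s p - j) := by
  refine (Set.ncard_image_le (Set.finite_Icc _ _)).trans ?_
  rw [Set.ncard_Icc_nat]
  omega

variable (hk : 6 ≤ k)

include hk

theorem eq_linkEdge_or_mem_ownEdges {e : Set (List ℕ × ℕ)} (he : e ∈ E(layered k s hk))
    (hj : (p, j) ∈ e) : e = linkEdge k s p ∨ e ∈ ownEdges k s p j := by
  obtain ⟨q, i, hi, rfl⟩ := (mem_edgeSet_layered hk).1 he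
  refine (layeredEdge_eq_linkEdge_or hi hj).imp_right ?_
  rintro ⟨rfl, him, hij, hj⟩
  have hi1 := hi.2.1
  exact ⟨i, ⟨by omega, by omega⟩, rfl⟩

theorem degree_layered_le (p : List ℕ) (j : ℕ) :
    degree (layered k s hk) (p, j) ≤ min j (2 * copySize k s p - j) + 1 := by
  have hsub : {e ∈ E(layered k s hk) | (p, j) ∈ e} ⊆ insert (linkEdge k s p) (ownEdges k s p j) :=
    fun e he => eq_linkEdge_or_mem_ownEdges hk he.1 he.2
  exact (Set.ncard_le_ncard hsub ((finite_ownEdges k s p j).insert _)).trans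
    ((Set.ncard_insert_le _ _).trans (Nat.succ_le_succ (ncard_ownEdges_le k s p j)))

theorem degree_layered_le_of_notMem (h : (p, j) ∉ linkEdge k s p) :
    degree (layered k s hk) (p, j) ≤ min j (2 * copySize k s p - j) := by
  have hsub : {e ∈ E(layered k s hk) | (p, j) ∈ e} ⊆ ownEdges k s p j := fun e he =>
    (eq_linkEdge_or_mem_ownEdges hk he.1 he.2).resolve_left fun heq => h (heq ▸ he.2)
  exact (Set.ncard_le_ncard hsub (finite_ownEdges k s p j)).trans (ncard_ownEdges_le k s p j)

theorem degree_layered_le_three (hj : j ∈ copyLastTwo k s p) :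
    degree (layered k s hk) (p, j) ≤ 3 := by
  have hdeg := degree_layered_le (s := s) hk p j
  rw [mem_copyLastTwo] at hj
  omega

theorem degree_lt_of_mem_lastEdge {x : List ℕ × ℕ} (hp : IsCopy k s p)
    (hx : x ∈ lastEdge k s p) (hne : x ≠ (p, copySize k s p)) :
    degree (layered k s hk) x < copySize k s p := by
  have h4 := four_le_copySize hk s p
  obtain ⟨q, j⟩ := x
  rcases mem_layeredEdge.1 hx with ⟨rfl, -⟩ | ⟨-, rfl, hj⟩
  · rw [mem_lastEdge_self hk] at hx
    have hjm : j ≠ copySize k s q := by rintro rfl; exact hne rfl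
    by_cases hj : (q, j) ∈ linkEdge k s q
    · have hdeg := degree_layered_le (s := s) hk q j
      suffices j ≠ copySize k s q + 1 by omega
      rintro rfl
      cases q with
      | nil =>
        rw [mem_linkEdge_nil hk, copySize_nil] at hj
        omega
      | cons c q =>
        rw [mem_linkEdge_cons hp] at hj
        omega
    · have hdeg := degree_layered_le_of_notMem hk hj
      omega
  · have hdeg := degree_layered_le_three hk hj
    omega

theorem degree_lt_of_mem_star {x : List ℕ × ℕ} (hx : x ∈ linkEdge k s []) :
    degree (layered k s hk) x < k - 2 := by
  obtain ⟨q, j⟩ := x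
  rcases mem_layeredEdge.1 hx with ⟨rfl, hj⟩ | ⟨-, rfl, hj⟩
  · have hdeg := degree_layered_le (s := s) hk [] j
    rw [mem_copyEdge_star hk] at hj
    rw [copySize_nil] at hdeg
    omega
  · have hdeg := degree_layered_le_three hk hj
    omega

theorem finite_edgeSet_layered : E(layered k s hk).Finite :=
  (finite_vertexSet_layered hk).finite_subsets.subset fun _ he => he.subset_vertexSet

theorem copySize_le_degree (hp : IsCopy k s p) :
    copySize k s p ≤ degree (layered k s hk) (p, copySize k s p) := by
  have hidx : ∀ i ∈ Set.Icc 1 (copySize k s p), IsEdgeIndex k s p i := fun i hi =>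
    isEdgeIndex_of_le_copySize hp hi.1 hi.2
  have hinj : Set.InjOn (layeredEdge k s p) (Set.Icc 1 (copySize k s p)) := fun i hi a ha h =>
    ((layeredEdge_inj hk (hidx i hi) (hidx a ha)).1 h).2
  calc copySize k s p = (layeredEdge k s p '' Set.Icc 1 (copySize k s p)).ncard := by
        rw [hinj.ncard_image, Set.ncard_Icc_nat, Nat.add_sub_cancel]
    _ ≤ degree (layered k s hk) (p, copySize k s p) := by
        refine Set.ncard_le_ncard ?_ ((finite_edgeSet_layered hk).subset fun e he => he.1)
        rintro _ ⟨i, ⟨hi, him⟩, rfl⟩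
        exact ⟨layeredEdge_mem_edgeSet hk (hidx i ⟨hi, him⟩),
          mem_layeredEdge_self.2 ((mem_copyEdge hi him).2 (by omega))⟩

theorem edgeIndex_eq_of_degree_le_one {q : List ℕ} {a : ℕ} {x : List ℕ × ℕ}
    (hp : IsEdgeIndex k s p i) (hq : IsEdgeIndex k s q a) (hx : x ∈ layeredEdge k s p i)
    (hx' : x ∈ layeredEdge k s q a) (hdeg : degree (layered k s hk) x ≤ 1) : p = q ∧ i = a := by
  have hunique := (Set.ncard_le_one
    ((finite_edgeSet_layered hk).subset fun e he => he.1)).1 hdeg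
  exact (layeredEdge_inj hk hp hq).1 (hunique _ ⟨layeredEdge_mem_edgeSet hk hp, hx⟩ _
    ⟨layeredEdge_mem_edgeSet hk hq, hx'⟩)

theorem eq_end_of_degree_le_one {x : List ℕ × ℕ} (hp : IsEdgeIndex k s p i)
    (him : i ≤ copySize k s p) (hx : x ∈ layeredEdge k s p i)
    (hdeg : degree (layered k s hk) x ≤ 1) :
    i = 1 ∧ x = (p, 1) ∨ i = copySize k s p ∧ x = (p, 2 * copySize k s p - 1) := by
  have h4 := four_le_copySize hk s p
  have hi := hp.2.1
  obtain ⟨q, j⟩ := x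
  rcases mem_layeredEdge.1 hx with ⟨rfl, hj⟩ | ⟨hl, rfl, hj⟩
  · rw [mem_copyEdge hi him] at hj
    have honly : ∀ a, 1 ≤ a → a ≤ copySize k s q → a ≤ j → j < a + copySize k s q → i = a := by
      intro a ha ham haj hja
      exact (edgeIndex_eq_of_degree_le_one hk hp (isEdgeIndex_of_le_copySize hp.1 ha ham) hx
        (mem_layeredEdge_self.2 ((mem_copyEdge ha ham).2 ⟨haj, hja⟩)) hdeg).2
    have hpred := honly (i - 1)
    have hsucc := honly (i + 1)
    simp only [Prod.mk.injEq, true_and]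
    omega
  · have hcopy := isCopy_cons_iff.2 ⟨hp, hl⟩
    have hlast : (i :: p, j) ∈ lastEdge k s (i :: p) := by
      have h4 := four_le_copySize hk s (i :: p)
      rw [mem_copyLastTwo] at hj
      rw [mem_lastEdge_self hk]
      omega
    have heq := edgeIndex_eq_of_degree_le_one hk hp (isEdgeIndex_copySize hk hcopy) hx hlast hdeg
    exact (List.cons_ne_self i p heq.1.symm).elim

end Degrees

/-- Every edge of `G_{k,s}` that contains a vertex of the copy `p` is fixed by `φ`. -/
def FixesEdgesAt {k s : ℕ} {hk : 6 ≤ k} (φ : V(layered k s hk) ≃ V(layered k s hk))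
    (p : List ℕ) : Prop :=
  ∀ e ∈ E(layered k s hk), ∀ j, (p, j) ∈ e → mapEdge φ e = e

section Automorphism

variable {k s : ℕ} {hk : 6 ≤ k} {p : List ℕ} {i c : ℕ}
  {φ : V(layered k s hk) ≃ V(layered k s hk)}

theorem apply_eq_of_mapEdge_lastEdge (hφ : IsIso φ) (hp : IsCopy k s p)
    (hlast : mapEdge φ (lastEdge k s p) = lastEdge k s p) {v : V(layered k s hk)}
    (hv : (v : List ℕ × ℕ) = (p, copySize k s p)) :
    (φ v : List ℕ × ℕ) = (p, copySize k s p) := by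
  have h4 := four_le_copySize hk s p
  by_contra hne
  have hmem : (φ v : List ℕ × ℕ) ∈ lastEdge k s p := by
    rw [← hlast, mem_mapEdge, hv, mem_lastEdge_self hk]
    omega
  have hdeg := degree_lt_of_mem_lastEdge hk hp hmem hne
  rw [degree_apply_eq hφ, hv] at hdeg
  exact hdeg.not_ge (copySize_le_degree hk hp)

theorem mapEdge_layeredEdge_of_lastEdge (hφ : IsIso φ) (hp : IsCopy k s p)
    (hlast : mapEdge φ (lastEdge k s p) = lastEdge k s p) (hi : 1 ≤ i)
    (him : i ≤ copySize k s p) : mapEdge φ (layeredEdge k s p i) = layeredEdge k s p i := by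
  have h4 := four_le_copySize hk s p
  rcases him.eq_or_lt with rfl | him'
  · exact hlast
  have hidx := isEdgeIndex_of_le_copySize hp hi him
  have hcentre : (p, copySize k s p) ∈ layeredEdge k s p i :=
    mem_layeredEdge_self.2 ((mem_copyEdge hi him).2 (by omega))
  obtain ⟨q, a, ha, himage⟩ :=
    (mem_edgeSet_layered hk).1 (mapEdge_mem_edgeSet hφ (layeredEdge_mem_edgeSet hk hidx))
  have hcentre' : (p, copySize k s p) ∈ layeredEdge k s q a := by
    let v : V(layered k s hk) :=
      ⟨_, mem_vertexSet_of_mem_edgeSet (layeredEdge_mem_edgeSet hk hidx) hcentre⟩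
    rw [← himage, ← apply_eq_of_mapEdge_lastEdge hφ hp hlast (v := v) rfl, mem_mapEdge]
    exact hcentre
  have hlink : (p, copySize k s p) ∉ linkEdge k s p := by
    cases p with
    | nil =>
      rw [mem_linkEdge_nil hk, copySize_nil]
      omega
    | cons c p =>
      rw [mem_linkEdge_cons hp]
      omega
  obtain ⟨rfl, ham, -⟩ := (layeredEdge_eq_linkEdge_or ha hcentre').resolve_left
    fun h => hlink (h ▸ hcentre')
  have hinter := ncard_mapEdge_inter (φ := φ) (f := lastEdge k s q)
    (layeredEdge_mem_edgeSet hk hidx)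
  rw [himage, hlast, ncard_layeredEdge_inter_lastEdge hk hi him'] at hinter
  rcases ham.eq_or_lt with rfl | ham'
  · have heq := mapEdge_injOn (φ := φ) (layeredEdge_mem_edgeSet hk hidx)
      (layeredEdge_mem_edgeSet hk ha) (himage.trans hlast.symm)
    exact (him'.ne ((layeredEdge_inj hk hidx ha).1 heq).2).elim
  · rw [ncard_layeredEdge_inter_lastEdge hk ha.2.1 ham'] at hinter
    rw [himage, hinter]

theorem fixesEdgesAt_of_lastEdge (hφ : IsIso φ) (hp : IsCopy k s p)
    (hlink : mapEdge φ (linkEdge k s p) = linkEdge k s p)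
    (hlast : mapEdge φ (lastEdge k s p) = lastEdge k s p) : FixesEdgesAt φ p := by
  rintro e he j hj
  obtain ⟨q, i, hi, rfl⟩ := (mem_edgeSet_layered hk).1 he
  rcases layeredEdge_eq_linkEdge_or hi hj with h | ⟨rfl, him, -⟩
  · rw [h, hlink]
  · exact mapEdge_layeredEdge_of_lastEdge hφ hp hlast hi.2.1 him

theorem mapEdge_star (hφ : IsIso φ) : mapEdge φ (linkEdge k s []) = linkEdge k s [] := by
  obtain ⟨p, i, hi, himage⟩ :=
    (mem_edgeSet_layered hk).1 (mapEdge_mem_edgeSet hφ (linkEdge_mem_edgeSet hk .nil))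
  rcases hi.le_copySize_or with him | ⟨rfl, rfl⟩
  · have hi1 := hi.2.1
    have hcentre : (p, copySize k s p) ∈ mapEdge φ (linkEdge k s []) :=
      himage ▸ mem_layeredEdge_self.2 ((mem_copyEdge hi1 him).2 (by omega))
    obtain ⟨x, hx, hφx⟩ := exists_of_mem_mapEdge hcentre
    have hlt := degree_lt_of_mem_star hk hx
    rw [← degree_apply_eq hφ, hφx] at hlt
    have hle := copySize_le_degree hk hi.1
    have hsize := sub_two_le_copySize (k := k) (s := s) (p := p)
    omega
  · exact himage

theorem eq_nil_or_of_mem_star {x : List ℕ × ℕ} (hi : IsEdgeIndex k s p i)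
    (hne : layeredEdge k s p i ≠ linkEdge k s []) (hx : x ∈ layeredEdge k s p i)
    (hstar : x ∈ linkEdge k s []) :
    p = [] ∨ p = [k - 1] ∧ copySize k s p ≤ i + 1 := by
  obtain ⟨q, j⟩ := x
  rcases mem_layeredEdge.1 hstar with ⟨rfl, -⟩ | ⟨-, rfl, hj⟩
  · exact .inl ((layeredEdge_eq_linkEdge_or hi hx).resolve_left hne).1
  · obtain ⟨rfl, -, hij⟩ := (layeredEdge_eq_linkEdge_or hi hx).resolve_left hne
    rw [mem_copyLastTwo] at hj
    exact .inr ⟨rfl, by omega⟩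

theorem layeredEdge_eq_lastEdge_nil {x y : List ℕ × ℕ} (hi : IsEdgeIndex k s p i)
    (hne : layeredEdge k s p i ≠ linkEdge k s [])
    (hx : x ∈ layeredEdge k s p i) (hx_star : x ∈ linkEdge k s [])
    (hy : y ∈ layeredEdge k s p i) (hy_star : y ∉ linkEdge k s [])
    (hy_degree : degree (layered k s hk) y ≤ 1) : layeredEdge k s p i = lastEdge k s [] := by
  have h4 := four_le_copySize hk s p
  have him := hi.le_copySize_or.resolve_right (by rintro ⟨rfl, rfl⟩; exact hne rfl)
  have hends := eq_end_of_degree_le_one hk hi him hy hy_degree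
  rcases eq_nil_or_of_mem_star hi hne hx hx_star with rfl | ⟨rfl, him'⟩
  · rcases hends with ⟨-, h⟩ | ⟨rfl, -⟩
    · rw [h, mem_linkEdge_nil hk] at hy_star
      omega
    · rfl
  · rcases hends with ⟨rfl, -⟩ | ⟨-, h⟩
    · omega
    · rw [h] at hy_star
      exact (hy_star ((mem_linkEdge_cons hi.1).2 (.inr rfl))).elim

theorem mapEdge_lastEdge_nil (hφ : IsIso φ) :
    mapEdge φ (lastEdge k s []) = lastEdge k s [] := by
  have hidx := isEdgeIndex_copySize hk (IsCopy.nil (k := k) (s := s))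
  have hmem := layeredEdge_mem_edgeSet hk hidx
  obtain ⟨p, i, hi, himage⟩ := (mem_edgeSet_layered hk).1 (mapEdge_mem_edgeSet hφ hmem)
  change mapEdge φ (lastEdge k s []) = _ at himage
  have hne : layeredEdge k s p i ≠ linkEdge k s [] := fun h => by
    have heq := mapEdge_injOn hmem (linkEdge_mem_edgeSet hk .nil)
      ((himage.trans h).trans (mapEdge_star hφ).symm)
    have := ((layeredEdge_inj hk hidx (isEdgeIndex_star hk)).1 heq).2
    rw [copySize_nil] at this
    omega
  have hlift : ∀ j, ([], j) ∈ lastEdge k s [] → ∃ v : V(layered k s hk), v.1 = ([], j) ∧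
      (φ v : List ℕ × ℕ) ∈ layeredEdge k s p i := fun j hj =>
    ⟨⟨_, mem_vertexSet_of_mem_edgeSet hmem hj⟩, rfl, himage ▸ (mem_mapEdge _).2 hj⟩
  have hstar (v : V(layered k s hk)) :
      (φ v : List ℕ × ℕ) ∈ linkEdge k s [] ↔ (v : List ℕ × ℕ) ∈ linkEdge k s [] := by
    rw [← mem_mapEdge (φ := φ) v, mapEdge_star hφ]
  simp only [mem_lastEdge_self hk, copySize_nil] at hlift
  obtain ⟨w, hw, hφw⟩ := hlift k (by omega)
  obtain ⟨u, hu, hφu⟩ := hlift (2 * (k - 2) - 1) (by omega)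
  have hu_star : ([], 2 * (k - 2) - 1) ∉ linkEdge k s [] := by
    rw [mem_linkEdge_nil hk]
    omega
  have hu_degree : degree (layered k s hk) (φ u) ≤ 1 := by
    rw [degree_apply_eq hφ, hu]
    refine (degree_layered_le_of_notMem hk hu_star).trans ?_
    rw [copySize_nil]
    omega
  exact himage.trans (layeredEdge_eq_lastEdge_nil hi hne hφw
    (by rw [hstar, hw, mem_linkEdge_nil hk]; omega) hφu (by rwa [hstar, hu]) hu_degree)

theorem notMem_lastEdge_cons {j : ℕ} : (p, j) ∉ lastEdge k s (c :: p) := by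
  intro h
  rcases mem_layeredEdge.1 h with ⟨h, -⟩ | ⟨-, h, -⟩ <;>
    have hlength := congrArg List.length h <;>
    simp only [List.length_cons] at hlength <;>
    omega

theorem layeredEdge_eq_lastEdge_cons {t : List ℕ} (hk : 6 ≤ k) (hcopy : IsCopy k s (c :: p))
    (hi : IsEdgeIndex k s t i) (hmeet : ∀ j, (p, j) ∉ layeredEdge k s t i)
    (hcard : (layeredEdge k s t i ∩ linkEdge k s (c :: p)).ncard = 2) :
    layeredEdge k s t i = lastEdge k s (c :: p) := by
  have hlastTwo : layeredEdge k s t i ∩ linkEdge k s (c :: p) =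
      Prod.mk (c :: p) '' copyLastTwo k s (c :: p) := by
    have hncard : (Prod.mk (c :: p) '' copyLastTwo k s (c :: p)).ncard = 2 := by
      rw [Set.ncard_image_of_injective _ (Prod.mk_right_injective _), ncard_copyLastTwo hk]
    refine Set.eq_of_subset_of_ncard_le ?_ (hncard.trans hcard.symm).le
      (Set.finite_of_ncard_ne_zero (hncard.trans_ne two_ne_zero))
    rintro ⟨q, l⟩ ⟨hl, hl_link⟩
    rcases mem_layeredEdge.1 hl_link with ⟨rfl, -⟩ | ⟨-, rfl, hl_last⟩
    · exact (hmeet l hl).elim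
    · exact ⟨l, hl_last, rfl⟩
  have hend : (c :: p, 2 * copySize k s (c :: p) - 1) ∈ layeredEdge k s t i :=
    (hlastTwo.ge ⟨_, mem_copyLastTwo.2 (.inr rfl), rfl⟩).1
  obtain ⟨j, hj⟩ := exists_mem_layeredEdge_self hk (isCopy_cons_iff.1 hcopy).1
  obtain ⟨rfl, him, -, hlt⟩ := (layeredEdge_eq_linkEdge_or hi hend).resolve_left
    fun h => hmeet j (h ▸ hj)
  obtain rfl : i = copySize k s (c :: p) := by
    have h4 := four_le_copySize hk s (c :: p)
    omega
  rfl

theorem mapEdge_lastEdge_cons (hφ : IsIso φ) (hcopy : IsCopy k s (c :: p))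
    (hfix : FixesEdgesAt φ p) :
    mapEdge φ (lastEdge k s (c :: p)) = lastEdge k s (c :: p) := by
  have hmem : lastEdge k s (c :: p) ∈ E(layered k s hk) :=
    layeredEdge_mem_edgeSet hk (isEdgeIndex_copySize hk hcopy)
  obtain ⟨t, i, hi, himage⟩ := (mem_edgeSet_layered hk).1 (mapEdge_mem_edgeSet hφ hmem)
  have hmeet (j : ℕ) : (p, j) ∉ layeredEdge k s t i := fun hj => by
    have hti := layeredEdge_mem_edgeSet hk hi
    have heq := mapEdge_injOn hmem hti (himage.trans (hfix _ hti j hj).symm)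
    exact notMem_lastEdge_cons (heq ▸ hj)
  have hc := (isCopy_cons_iff.1 hcopy).1
  obtain ⟨j, hj⟩ := exists_mem_layeredEdge_self hk hc
  have hlink : mapEdge φ (linkEdge k s (c :: p)) = linkEdge k s (c :: p) :=
    hfix _ (layeredEdge_mem_edgeSet hk hc) j hj
  have hcard := ncard_mapEdge_inter (φ := φ) (f := linkEdge k s (c :: p)) hmem
  rw [himage, hlink, lastEdge_inter_linkEdge hk hcopy,
    Set.ncard_image_of_injective _ (Prod.mk_right_injective _), ncard_copyLastTwo hk] at hcard
  exact himage.trans (layeredEdge_eq_lastEdge_cons hk hcopy hi hmeet hcard)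

theorem fixesEdgesAt (hφ : IsIso φ) (hp : IsCopy k s p) : FixesEdgesAt φ p := by
  induction p with
  | nil => exact fixesEdgesAt_of_lastEdge hφ hp (mapEdge_star hφ) (mapEdge_lastEdge_nil hφ)
  | cons c p ih =>
    have hc := (isCopy_cons_iff.1 hp).1
    have hfix := ih hc.1
    obtain ⟨j, hj⟩ := exists_mem_layeredEdge_self hk hc
    exact fixesEdgesAt_of_lastEdge hφ hp (hfix _ (layeredEdge_mem_edgeSet hk hc) j hj)
      (mapEdge_lastEdge_cons hφ hp hfix)

theorem isAsymmetric_layered (hk : 6 ≤ k) : IsAsymmetric (layered k s hk) := by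
  intro φ hφ
  refine eq_refl_of_mapEdge_eq (fun x hx y hy => eq_of_areTwins hk hx hy) fun e he => ?_
  obtain ⟨p, i, hi, rfl⟩ := (mem_edgeSet_layered hk).1 he
  obtain ⟨j, hj⟩ := exists_mem_layeredEdge_self hk hi
  exact fixesEdgesAt hφ hi.1 _ he j hj

end Automorphism

end LayeredComposition

theorem theorem4 (k : ℕ) (hk : 6 ≤ k) :
    (∀ s : ℕ,
      (Hypergraph.layered k s hk).IsKGraph k ∧
      (Hypergraph.layered k s hk).IsAsymmetric ∧
      ∀ H : Hypergraph (List ℕ × ℕ),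
        H.IsSubhypergraph (Hypergraph.layered k s hk) → H ≠ Hypergraph.layered k s hk →
        2 ≤ H.vertexSet.ncard → H.HasInvolution) ∧
    ∀ s t : ℕ, s ≠ t →
      ¬ (Hypergraph.layered k s hk).Isomorphic (Hypergraph.layered k t hk) := by
  refine ⟨fun s => ⟨LayeredComposition.isKGraph_layered hk,
    LayeredComposition.isAsymmetric_layered hk, fun H hsub hne hcard => ?_⟩,
    fun s t hst => LayeredComposition.not_isomorphic_layered hk hst⟩
  by_contra hinv
  exact hne (LayeredComposition.eq_layered_of_not_hasInvolution hsub hinv hcard)
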